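/- **Setting.** There are $K$ agents (arms) with values $\mu(a)\in[0,1]$ per click, $T$ rounds, and $m$ experts $h:\mathcal X\to\{1,\dots,K\}$. Contexts $x^t$ are i.i.d., and, given $x^t$, the ad of agent $a$ would be clicked ($c^t(a)=1$) with probability $\rho(a,x^t)\in[0,1]$. Put $\Pi(a,h)=\mathbb E_x[\rho(a,x)\mathbf 1\{h(x)=a\}]$ and $R(h)=\mathbb E_x[\mu(h(x))\rho(h(x),x)]$. **Adversary.** In each round, knowing the past, the current bids, the context and all $c^t(a)$, but not the mechanism's current random choices (explore or exploit, random arm), an adversary replaces $c^t(\cdot)$ by $\tilde c^t(\cdot)\in\{0,1\}^K$. The mechanism sees only $\tilde c^t(a^t)$. The total corruption is at most $C\ge 0$: $\sum_{t\le T}\max_a|\tilde c^t(a)-c^t(a)|\le C$ almost surely. The mechanism does not know $C$. **Mechanism (contextual $\varepsilon$-greedy).** In round $t$ the agents submit bids $b^t(a)\in[0,1]$, depending arbitrarily on the past. With probability $\varepsilon$ (explore) a uniformly random arm $a^t$ is displayed free of charge. Otherwise (exploit) the mechanism displays $a^t=h^t(x^t)$, where $h^t\in\arg\max_h\sum_i\hat\Pi^t(i,h)\,b^t(i)$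 (any fixed tie-breaking rule) and $$\hat\Pi^t(a,h)=\frac{K}{|t_e|}\sum_{\tau\in t_e}\mathbf 1\{h(x^\tau)=a\}\,\mathbf 1\{a^\tau=a\}\,\tilde c^\tau(a),$$ with $t_e$ the set of explore rounds before $t$ ($\hat\Pi^t=0$ if $t_e=\emptyset$). If agent $a$ bids $y$ and the other bids are as in $b^t$, let $h_{a,y}$ be the chosen expert, $\hat g^t(a,y)=\hat\Pi^t(a,h_{a,y})$ and $g^t(a,y)=\Pi(a,h_{a,y})$. The price per click is $p^t(a,y)=y-\int_0^y\hat g^t(a,z)\,dz/\hat g^t(a,y)$ if $\hat g^t(a,y)>0$, and $0$ otherwise. The utility is $u^t(a,y)=(\mu(a)-p^t(a,y))\,g^t(a,y)$. **Agents.** All agents are $\alpha$-rational, $\alpha\in(0,1]$: agent $a$ bids $b^t(a)=\mu(a)$ in every round $t$ with $\sup_{y\in[0,1]}u^t(a,y)-u^t(a,\mu(a))\le\alpha$. **Theorem.** Let $\mathrm{Reg}(T)=\mathbb E\big[T\max_hR(h)-\sum_{t=1}^Tc^t(a^t)\mu(a^t)\big]$. For every $\varepsilon\in(0,1]$, $$\mathrm{Reg}(T)\le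 T\varepsilon+K^2\sqrt{\frac{8T\log(TmK)}{\varepsilon}}+3K+\frac{8K^2\log(TmK)}{\varepsilon\alpha^2}+\frac{16C'}{\alpha}+4KC'\log T,\qquad C'=C+\max\Big\{C,\frac{6K\log T}{\varepsilon}\Big\}.$$ Moreover, there are absolute constants $c,p$ such that for $\varepsilon=\min\{1,\,2T^{-1/3}\log(TmK)^{1/3}K^{4/3}\}$, $$\mathrm{Reg}(T)\le c\,(1+\log(TmK))^p\Big(T^{2/3}K^{4/3}+\frac{T^{1/3}K^{2/3}}{\alpha^2}+\frac C\alpha+KC\Big).$$ -/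

import Mathlib

open MeasureTheory ProbabilityTheory

noncomputable section

/-- A contextual pay-per-click instance with `K` agents and `m` experts: the law of the i.i.d.
contexts, the click-through rates `ρ`, the experts `h : X → Fin K`, and the agents' values `μ`. -/
structure PPCInstance (X : Type*) [MeasurableSpace X] (K m : ℕ) where
  ctxLaw : Measure X
  isProb : IsProbabilityMeasure ctxLaw
  ctr : Fin K → X → ℝ
  ctr_measurable : ∀ a, Measurable (ctr a)
  ctr_mem : ∀ a x, ctr a x ∈ Set.Icc (0 : ℝ) 1
  expert : Fin m → X → Fin K
  expert_measurable : ∀ h, Measurable (expert h)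
  value : Fin K → ℝ
  value_mem : ∀ a, value a ∈ Set.Icc (0 : ℝ) 1

namespace PPCInstance

variable {X : Type*} [MeasurableSpace X] {K m : ℕ}

/-- `Π(a,h) = E_x[ρ(a,x) 1{h(x) = a}]`. -/
def clickProb (I : PPCInstance X K m) (a : Fin K) (h : Fin m) : ℝ :=
  ∫ x, I.ctr a x * (if I.expert h x = a then 1 else 0) ∂I.ctxLaw

/-- `R(h,μ) = E_x[μ(h(x)) ρ(h(x),x)]`. -/
def welfare (I : PPCInstance X K m) (h : Fin m) : ℝ :=
  ∫ x, I.value (I.expert h x) * I.ctr (I.expert h x) x ∂I.ctxLaw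

/-- `R(h⋆,μ) = max_h R(h,μ)`. -/
def bestWelfare (I : PPCInstance X K m) : ℝ := ⨆ h, I.welfare h

end PPCInstance

/-- A way to resolve `argmax_h ∑ i, Q(i,h) b(i)`, with arbitrary (measurable) tie-breaking. -/
structure GreedyRule (K m : ℕ) where
  choose : (Fin K → Fin m → ℝ) → (Fin K → ℝ) → Fin m
  isMax : ∀ (Q : Fin K → Fin m → ℝ) (b : Fin K → ℝ) (h : Fin m),
    ∑ i, Q i h * b i ≤ ∑ i, Q i (choose Q b) * b i
  measurable_choose : ∀ Q : Fin K → Fin m → ℝ, Measurable (choose Q)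

namespace GreedyRule

variable {K m : ℕ}

/-- The expert followed when agent `a` bids `y` and the others bid as in `b`. -/
def expertAt (G : GreedyRule K m) (Q : Fin K → Fin m → ℝ) (b : Fin K → ℝ) (a : Fin K) (y : ℝ) :
    Fin m :=
  G.choose Q (Function.update b a y)

/-- The estimated click probability `ĝ(a,y)`, for estimates `Q` of `Π`. -/
def gHat (G : GreedyRule K m) (Q : Fin K → Fin m → ℝ) (b : Fin K → ℝ) (a : Fin K) (y : ℝ) : ℝ :=
  Q a (G.expertAt Q b a y)

/-- The price charged in an exploit round to agent `a`, upon a click, for the bid `y`. -/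
def price (G : GreedyRule K m) (Q : Fin K → Fin m → ℝ) (b : Fin K → ℝ) (a : Fin K) (y : ℝ) : ℝ :=
  if 0 < G.gHat Q b a y then y - (∫ z in (0 : ℝ)..y, G.gHat Q b a z) / G.gHat Q b a y else 0

/-- The expected utility `u(a,y) = (μ(a) - p(a,y)) g(a,y)` of agent `a` in an exploit round, where
`g(a,y) = E_x[ρ(a,x) 1{h(x) = a}]` for the expert `h` that is followed when `a` bids `y`. In an
explore round nothing is charged and the utility does not depend on the bid. -/
def utility {X : Type*} [MeasurableSpace X] (G : GreedyRule K m) (I : PPCInstance X K m)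
    (Q : Fin K → Fin m → ℝ) (b : Fin K → ℝ) (a : Fin K) (y : ℝ) : ℝ :=
  (I.value a - G.price Q b a y) * I.clickProb a (G.expertAt Q b a y)

end GreedyRule

/-- A random execution, over rounds `t < T`, of the contextual `ε`-greedy mechanism with strategic
agents and an adversary that corrupts clicks.

* `hist t` is the information generated before round `t`; the bids of round `t` may depend on it
  in an arbitrary way.
* `click t ω a` says whether the user of round `t` would click on the ad of agent `a`; the context
  and these clicks are drawn afresh in each round.
* `seen t ω a` is the click result after corruption. The adversary may use the whole past, the
  current bids, the current context and all current clicks, but not the current lottery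
  `(explore t, draw t)` of the mechanism.
* `explore t` is the coin of bias `ε` and `draw t` the uniformly random arm, which is displayed
  if `explore t` holds. -/
structure Execution {X : Type*} [MeasurableSpace X] {K m : ℕ} (I : PPCInstance X K m)
    (ε : ℝ) (T : ℕ) {Ω : Type*} [mΩ : MeasurableSpace Ω] (P : Measure Ω) where
  hist : Filtration ℕ mΩ
  bid : ℕ → Ω → Fin K → ℝ
  ctx : ℕ → Ω → X
  click : ℕ → Ω → Fin K → Bool
  seen : ℕ → Ω → Fin K → Bool
  explore : ℕ → Ω → Bool
  draw : ℕ → Ω → Fin K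
  bid_mem : ∀ t < T, ∀ ω a, bid t ω a ∈ Set.Icc (0 : ℝ) 1
  bid_measurable : ∀ t < T, Measurable[hist t] (bid t)
  ctx_measurable : ∀ t < T, Measurable[hist (t + 1)] (ctx t)
  click_measurable : ∀ t < T, Measurable[hist (t + 1)] (click t)
  seen_measurable : ∀ t < T, Measurable[hist (t + 1)] (seen t)
  explore_measurable : ∀ t < T, Measurable[hist (t + 1)] (explore t)
  draw_measurable : ∀ t < T, Measurable[hist (t + 1)] (draw t)
  ctx_law : ∀ t < T, P.map (ctx t) = I.ctxLaw
  /-- Given the context `x`, the ad of `a` is clicked with probability `ρ(a,x)`. -/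
  click_law : ∀ t < T, ∀ a, ∀ B : Set X, MeasurableSet B →
    P {ω | ctx t ω ∈ B ∧ click t ω a = true} = ∫⁻ x in B, ENNReal.ofReal (I.ctr a x) ∂I.ctxLaw
  /-- The context and the clicks of round `t` are independent of the past. -/
  user_indep : ∀ t < T,
    Indep (hist t) (MeasurableSpace.comap (fun ω => (ctx t ω, click t ω)) inferInstance) P
  explore_law : ∀ t < T, ∀ a,
    P {ω | explore t ω = true ∧ draw t ω = a} = ENNReal.ofReal (ε / K)
  exploit_law : ∀ t < T, ∀ a,
    P {ω | explore t ω = false ∧ draw t ω = a} = ENNReal.ofReal ((1 - ε) / K)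
  /-- The lottery of round `t` is independent of the past together with the context, the clicks
  and the corrupted clicks of round `t`. -/
  lottery_indep : ∀ t < T,
    Indep (hist t ⊔ MeasurableSpace.comap (fun ω => (ctx t ω, click t ω, seen t ω)) inferInstance)
      (MeasurableSpace.comap (fun ω => (explore t ω, draw t ω)) inferInstance) P

namespace Execution

variable {X : Type*} [MeasurableSpace X] {K m : ℕ} {I : PPCInstance X K m} {ε : ℝ} {T : ℕ}
  {Ω : Type*} [mΩ : MeasurableSpace Ω] {P : Measure Ω}

/-- The number of explore rounds before round `t`. -/
def numExplore (E : Execution I ε T P) (t : ℕ) (ω : Ω) : ℕ :=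
  ((Finset.range t).filter fun τ => E.explore τ ω = true).card

/-- The number of explore rounds `τ < t` with `h(x^τ) = a`, `a^τ = a` and a reported click. -/
def numHits (E : Execution I ε T P) (t : ℕ) (ω : Ω) (a : Fin K) (h : Fin m) : ℕ :=
  ((Finset.range t).filter fun τ => E.explore τ ω = true ∧ I.expert h (E.ctx τ ω) = a ∧
    E.draw τ ω = a ∧ E.seen τ ω a = true).card

/-- The empirical estimate `Π̂^t(a,h)`; it is `0` while there has been no explore round. -/
def estimate (E : Execution I ε T P) (t : ℕ) (ω : Ω) (a : Fin K) (h : Fin m) : ℝ :=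
  (E.numHits t ω a h : ℝ) * K / E.numExplore t ω

/-- The arm `a^t` displayed in round `t`. -/
def arm (E : Execution I ε T P) (G : GreedyRule K m) (t : ℕ) (ω : Ω) : Fin K :=
  if E.explore t ω = true then E.draw t ω
  else I.expert (G.choose (E.estimate t ω) (E.bid t ω)) (E.ctx t ω)

/-- Almost surely the adversary corrupts a total amount
`∑ t, max_a |c̃^t(a) - c^t(a)| = #{t | c̃^t ≠ c^t}` of at most `C`. -/
def CorruptedAtMost (E : Execution I ε T P) (C : ℝ) : Prop :=
  ∀ᵐ ω ∂P, (((Finset.range T).filter fun t => E.seen t ω ≠ E.click t ω).card : ℝ) ≤ C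

/-- All agents are `α`-rational: an agent who could gain at most `α` in a round over bidding
truthfully bids truthfully in that round. -/
def AlphaRational (E : Execution I ε T P) (G : GreedyRule K m) (α : ℝ) : Prop :=
  ∀ t < T, ∀ a : Fin K, ∀ᵐ ω ∂P,
    (∀ y ∈ Set.Icc (0 : ℝ) 1, G.utility I (E.estimate t ω) (E.bid t ω) a y
      - G.utility I (E.estimate t ω) (E.bid t ω) a (I.value a) ≤ α) →
    E.bid t ω a = I.value a

/-- The expected welfare regret `E[T R(h⋆,μ) - ∑ t, c^t μ(a^t)]`, with the genuine clicks. -/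
def expectedRegret (E : Execution I ε T P) (G : GreedyRule K m) : ℝ :=
  ∫ ω, (T * I.bestWelfare - ∑ t ∈ Finset.range T,
    (if E.click t ω (E.arm G t ω) = true then 1 else 0) * I.value (E.arm G t ω)) ∂P

end Execution

/-- `C' = C + max{C, 6 K log T / ε}`. -/
def corruptionTerm (K T : ℕ) (ε C : ℝ) : ℝ := C + max C (6 * K * Real.log T / ε)

end

/-!
By `expectedRegret_le_add_sum`, exploration costs at most `ε` per round, and an exploit round costs
the gap between the best welfare and the welfare of the chosen expert. It remains to bound this gap
when round `t` has enough data, that is for `t ≥ 8 K² log(TmK) / (ε α²) + 16 C' / α`; the earlier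
rounds cost at most `1` each.

*Concentration.* The number of explore rounds, the genuine explored rewards of each expert, and the
number of corrupted rounds in which a given arm is explored all have exponential tails. In each case
the exponential of the relevant sum is a supermartingale, because the lottery of a round is
independent of everything before it and the user of a round is independent of the past
(`measureReal_le_sum_le_exp_neg`). In particular only a fraction of about `ε / K` of the corrupted
rounds is effective on a given arm, since the adversary moves before the lottery. No union bound
over the rounds is needed: the regret of a round is at most `1`, so that a failure probability of
order `1 / T` in each round is affordable (`measureReal_badEvent_le_div`).

*Incentives.* The estimated click probability of an agent is monotone in the bid and the price is
Myerson's, so that truthful bidding is optimal for the estimated utilities. If the estimates are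
correct up to `δ`, then a false bid gains at most `2 δ` (`utility_sub_utility_le`), which is at most
`α` for late rounds off the exceptional event. Hence all agents are truthful there, and the greedy
choice is nearly optimal for the true values (`best_sub_welfare_le_of_notMem_badEvent`).

*Constants.* The welfare of an expert is estimated by one average of explored rewards, weighted
with the values, instead of `K` separate averages. This gains a factor `K` in the sampling error,
and for `K ≥ 2` that pays for having only half of the expected number of explore rounds. With one
arm all experts have the same welfare.
-/

/-! ### Integration and independence -/

section Probability

variable {Ω : Type*} {mΩ : MeasurableSpace Ω} {P : Measure Ω}

theorem integrable_of_abs_le [IsFiniteMeasure P] {f : Ω → ℝ} (hf : Measurable f) (B : ℝ)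
    (hB : ∀ ω, |f ω| ≤ B) : Integrable f P :=
  Integrable.of_bound hf.aestronglyMeasurable B (Filter.Eventually.of_forall hB)

theorem integral_mul_of_indep {m₁ m₂ : MeasurableSpace Ω} (h₁ : m₁ ≤ mΩ) (h₂ : m₂ ≤ mΩ)
    (h : Indep m₁ m₂ P) {f g : Ω → ℝ} (hf : Measurable[m₁] f) (hg : Measurable[m₂] g) :
    ∫ ω, f ω * g ω ∂P = (∫ ω, f ω ∂P) * ∫ ω, g ω ∂P := by
  have hI : IndepFun f g P := by
    rw [IndepFun_iff_Indep]
    exact indep_of_indep_of_le_right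
      (indep_of_indep_of_le_left h hf.comap_le) hg.comap_le
  exact hI.integral_fun_mul_eq_mul_integral
    (hf.mono h₁ le_rfl).aestronglyMeasurable (hg.mono h₂ le_rfl).aestronglyMeasurable

theorem integral_add_mul_add_mul {f g h : Ω → ℝ} (hf : Integrable f P) (hg : Integrable g P)
    (hh : Integrable h P) (b c : ℝ) :
    ∫ ω, (f ω + g ω * b + h ω * c) ∂P
      = ∫ ω, f ω ∂P + (∫ ω, g ω ∂P) * b + (∫ ω, h ω ∂P) * c := by
  rw [← integral_mul_const, ← integral_mul_const, ← integral_add hf (hg.mul_const b)]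
  exact integral_add (hf.add (hg.mul_const b)) (hh.mul_const c)

theorem measurable_ite_one {m : MeasurableSpace Ω} {p : Ω → Prop} [DecidablePred p]
    (hp : MeasurableSet[m] {ω | p ω}) : Measurable[m] fun ω => if p ω then (1 : ℝ) else 0 :=
  Measurable.ite hp measurable_const measurable_const

theorem integral_ite_one {p : Ω → Prop} [DecidablePred p] (hp : MeasurableSet {ω | p ω}) :
    ∫ ω, (if p ω then (1 : ℝ) else 0) ∂P = P.real {ω | p ω} := by
  rw [← integral_indicator_one hp]
  refine integral_congr_ae (Filter.Eventually.of_forall fun ω => ?_)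
  by_cases h : p ω <;> simp [Set.indicator, h]

theorem measurable_card_filter {m : MeasurableSpace Ω} {t : ℕ} {p : ℕ → Ω → Prop}
    [∀ τ, DecidablePred (p τ)] (hp : ∀ τ < t, MeasurableSet[m] {ω | p τ ω}) :
    Measurable[m] fun ω => ((Finset.range t).filter fun τ => p τ ω).card := by
  simp only [Finset.card_filter]
  refine Finset.measurable_sum _ fun τ hτ => ?_
  exact Measurable.ite (hp τ (Finset.mem_range.1 hτ)) measurable_const measurable_const

theorem measurable_pi_pi {m : MeasurableSpace Ω} {α β γ : Type*} [MeasurableSpace γ]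
    {f : Ω → α → β → γ} (hf : ∀ a b, Measurable[m] fun ω => f ω a b) : Measurable[m] f :=
  measurable_pi_lambda _ fun a => measurable_pi_lambda _ fun b => hf a b

/-! ### Exponential supermartingales -/

/-- If every factor `exp Z_τ` has conditional expectation at most `1` given the past, then the sum
of the `Z_τ` has an exponential upper tail. The conditional bound is tested against nonnegative
bounded functions of the past. -/
theorem measureReal_le_sum_le_exp_neg [IsProbabilityMeasure P] {ℱ : Filtration ℕ mΩ}
    {Z : ℕ → Ω → ℝ} {T : ℕ} {B : ℝ}
    (hm : ∀ τ < T, Measurable[ℱ (τ + 1)] (Z τ)) (hB : ∀ τ < T, ∀ ω, Z τ ω ≤ B)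
    (hstep : ∀ τ < T, ∀ V : Ω → ℝ, Measurable[ℱ τ] V → (∀ ω, 0 ≤ V ω) → (∃ M, ∀ ω, V ω ≤ M) →
      ∫ ω, V ω * Real.exp (Z τ ω) ∂P ≤ ∫ ω, V ω ∂P)
    {t : ℕ} (ht : t ≤ T) (x : ℝ) :
    P.real {ω | x ≤ ∑ τ ∈ Finset.range t, Z τ ω} ≤ Real.exp (-x) := by
  have key : ∀ s ≤ T, Measurable[ℱ s] (fun ω => Real.exp (∑ τ ∈ Finset.range s, Z τ ω)) ∧
      (∀ ω, Real.exp (∑ τ ∈ Finset.range s, Z τ ω) ≤ Real.exp (s * B)) ∧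
      ∫ ω, Real.exp (∑ τ ∈ Finset.range s, Z τ ω) ∂P ≤ 1 := by
    intro s
    induction s with
    | zero => intro _; refine ⟨by simp, by simp, by simp⟩
    | succ s ih =>
      intro hs
      obtain ⟨i₁, i₂, i₃⟩ := ih (by omega)
      have hsum : Measurable[ℱ (s + 1)] fun ω => ∑ τ ∈ Finset.range (s + 1), Z τ ω := by
        refine Finset.measurable_sum _ fun τ hτ => ?_
        have := Finset.mem_range.1 hτ
        exact (hm τ (by omega)).mono (ℱ.mono (by omega)) le_rfl
      refine ⟨Real.measurable_exp.comp hsum, fun ω => ?_, ?_⟩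
      · refine Real.exp_le_exp.2 ?_
        calc _ ≤ ∑ τ ∈ Finset.range (s + 1), B := Finset.sum_le_sum fun τ hτ =>
              hB τ (by have := Finset.mem_range.1 hτ; omega) ω
          _ = _ := by simp
      · have := hstep s (by omega) _ i₁ (fun ω => (Real.exp_pos _).le) ⟨_, i₂⟩
        simp only [Finset.sum_range_succ, Real.exp_add]
        exact this.trans i₃
  obtain ⟨k₁, k₂, k₃⟩ := key t ht
  have hint : Integrable (fun ω => Real.exp (∑ τ ∈ Finset.range t, Z τ ω)) P :=
    integrable_of_abs_le (k₁.mono (ℱ.le t) le_rfl) _ fun ω => by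
      rw [abs_of_pos (Real.exp_pos _)]; exact k₂ ω
  have hM := mul_meas_ge_le_integral_of_nonneg
    (Filter.Eventually.of_forall fun ω => (Real.exp_pos _).le) hint (Real.exp x)
  simp only [Real.exp_le_exp] at hM
  rw [Real.exp_neg, ← one_div, le_div_iff₀ (Real.exp_pos _), mul_comm]
  exact hM.trans k₃

/-- Hoeffding's lemma for a Bernoulli variable of mean `q`, obtained from the general one for the
law `(1 - q) δ₀ + q δ₁`. -/
theorem one_add_mul_exp_sub_one_le {q : ℝ} (h0 : 0 ≤ q) (h1 : q ≤ 1) (l : ℝ) :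
    1 + q * (Real.exp l - 1) ≤ Real.exp (l * q + l ^ 2 / 8) := by
  let ν : Measure ℝ := ENNReal.ofReal (1 - q) • Measure.dirac 0 + ENNReal.ofReal q • Measure.dirac 1
  have hν : IsProbabilityMeasure ν := ⟨by
    simp [ν, ← ENNReal.ofReal_add (sub_nonneg.2 h1) h0]⟩
  have hi : ∀ f : ℝ → ℝ, ∫ x, f x ∂ν = (1 - q) * f 0 + q * f 1 := by
    intro f
    rw [integral_add_measure, integral_smul_measure, integral_smul_measure, integral_dirac,
      integral_dirac, ENNReal.toReal_ofReal h0, ENNReal.toReal_ofReal (sub_nonneg.2 h1)]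
    · simp
    · exact (integrable_dirac (by simp)).smul_measure (by simp)
    · exact (integrable_dirac (by simp)).smul_measure (by simp)
  have hs := (hasSubgaussianMGF_of_mem_Icc (μ := ν) (X := fun x => x) (a := 0) (b := 1)
    aemeasurable_id (by
      simp only [ν, ae_add_measure_iff]
      constructor <;> refine Measure.ae_smul_measure ?_ _ <;> simp [ae_dirac_eq])).mgf_le l
  rw [mgf, hi, hi] at hs
  have e : Real.exp (l * q + l ^ 2 / 8) = Real.exp (l * q) * Real.exp (l ^ 2 / 8) := Real.exp_add _ _
  have e2 : 1 + q * (Real.exp l - 1) = Real.exp (l * q) *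
      ((1 - q) * Real.exp (l * (0 - ((1 - q) * 0 + q * 1))) +
        q * Real.exp (l * (1 - ((1 - q) * 0 + q * 1)))) := by
    have a1 : Real.exp (l * q) * Real.exp (l * (0 - ((1 - q) * 0 + q * 1))) = 1 := by
      rw [← Real.exp_add]; simp
    have a2 : Real.exp (l * q) * Real.exp (l * (1 - ((1 - q) * 0 + q * 1))) = Real.exp l := by
      rw [← Real.exp_add]; congr 1; ring
    linear_combination -(1 - q) * a1 - q * a2
  rw [e, e2]
  refine mul_le_mul_of_nonneg_left (hs.trans (le_of_eq ?_)) (Real.exp_pos _).le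
  congr 1
  simp
  ring

/-- The exponential lies below its chord on `[0, 1]`. -/
theorem exp_mul_le_one_add {y : ℝ} (h0 : 0 ≤ y) (h1 : y ≤ 1) (l : ℝ) :
    Real.exp (l * y) ≤ 1 + y * (Real.exp l - 1) := by
  have := convexOn_exp.2 (Set.mem_univ 0) (Set.mem_univ l) (sub_nonneg.2 h1) h0 (by ring)
  simp only [smul_eq_mul, mul_zero, zero_add, Real.exp_zero, mul_one] at this
  rw [mul_comm l y]
  linarith

end Probability

/-! ### One round of an execution -/

namespace PPCInstance

variable {X : Type*} [MeasurableSpace X] {K m : ℕ}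

theorem integrable_clickProb (I : PPCInstance X K m) (a : Fin K) (h : Fin m) :
    Integrable (fun x => I.ctr a x * (if I.expert h x = a then 1 else 0)) I.ctxLaw := by
  have := I.isProb
  refine integrable_of_abs_le ((I.ctr_measurable a).mul
    (measurable_ite_one (I.expert_measurable h (measurableSet_singleton a)))) 1 fun x => ?_
  have := I.ctr_mem a x
  split_ifs
  · rw [mul_one, abs_of_nonneg this.1]; exact this.2
  · simp

theorem clickProb_nonneg (I : PPCInstance X K m) (a : Fin K) (h : Fin m) :
    0 ≤ I.clickProb a h := by
  refine integral_nonneg fun x => mul_nonneg (I.ctr_mem a x).1 ?_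
  split_ifs <;> simp

theorem ctr_expert_eq_sum (I : PPCInstance X K m) (w : Fin K → ℝ) (h : Fin m) (x : X) :
    w (I.expert h x) * I.ctr (I.expert h x) x =
      ∑ a, w a * (I.ctr a x * (if I.expert h x = a then 1 else 0)) := by
  simp

theorem sum_mul_clickProb (I : PPCInstance X K m) (w : Fin K → ℝ) (h : Fin m) :
    ∑ a, w a * I.clickProb a h = ∫ x, w (I.expert h x) * I.ctr (I.expert h x) x ∂I.ctxLaw := by
  simp only [ctr_expert_eq_sum]
  rw [integral_finsetSum _ fun a _ => (I.integrable_clickProb a h).const_mul _]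
  simp only [integral_const_mul, clickProb]

theorem sum_mul_clickProb_le_one (I : PPCInstance X K m) {w : Fin K → ℝ} (hw0 : ∀ a, 0 ≤ w a)
    (hw1 : ∀ a, w a ≤ 1) (h : Fin m) : ∑ a, w a * I.clickProb a h ≤ 1 := by
  have := I.isProb
  rw [sum_mul_clickProb]
  calc _ ≤ ∫ _, (1 : ℝ) ∂I.ctxLaw := by
        refine integral_mono_of_nonneg (Filter.Eventually.of_forall fun x => ?_)
          (integrable_const _) (Filter.Eventually.of_forall fun x => ?_)
        · exact mul_nonneg (hw0 _) (I.ctr_mem _ x).1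
        · exact mul_le_one₀ (hw1 _) (I.ctr_mem _ x).1 (I.ctr_mem _ x).2
    _ = 1 := by simp

theorem welfare_eq_sum (I : PPCInstance X K m) (h : Fin m) :
    I.welfare h = ∑ a, I.value a * I.clickProb a h :=
  (I.sum_mul_clickProb I.value h).symm

theorem welfare_nonneg (I : PPCInstance X K m) (h : Fin m) : 0 ≤ I.welfare h := by
  rw [welfare_eq_sum]
  exact Finset.sum_nonneg fun a _ => mul_nonneg (I.value_mem a).1 (I.clickProb_nonneg a h)

theorem welfare_le_one (I : PPCInstance X K m) (h : Fin m) : I.welfare h ≤ 1 := by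
  rw [welfare_eq_sum]
  exact I.sum_mul_clickProb_le_one (fun a => (I.value_mem a).1) (fun a => (I.value_mem a).2) h

theorem bestWelfare_le_one (I : PPCInstance X K m) : I.bestWelfare ≤ 1 :=
  Real.iSup_le I.welfare_le_one zero_le_one

end PPCInstance

namespace Execution

variable {X : Type*} [MeasurableSpace X] {K m : ℕ} {I : PPCInstance X K m} {ε : ℝ} {T : ℕ}
  {Ω : Type*} [mΩ : MeasurableSpace Ω] {P : Measure Ω}

/-- The information that is independent of the lottery of round `t`: the past together with the
context, the clicks and the corrupted clicks of round `t`. -/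
abbrev preLottery (E : Execution I ε T P) (t : ℕ) : MeasurableSpace Ω :=
  E.hist t ⊔ MeasurableSpace.comap (fun ω => (E.ctx t ω, E.click t ω, E.seen t ω)) inferInstance

theorem comap_user_le (E : Execution I ε T P) {t : ℕ} (ht : t < T) :
    MeasurableSpace.comap (fun ω => (E.ctx t ω, E.click t ω, E.seen t ω)) inferInstance
      ≤ E.hist (t + 1) :=
  Measurable.comap_le (Measurable.prodMk (E.ctx_measurable t ht)
    (Measurable.prodMk (E.click_measurable t ht) (E.seen_measurable t ht)))

theorem preLottery_le_hist (E : Execution I ε T P) {t : ℕ} (ht : t < T) :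
    E.preLottery t ≤ E.hist (t + 1) :=
  sup_le (E.hist.mono (Nat.le_succ t)) (E.comap_user_le ht)

theorem preLottery_le (E : Execution I ε T P) {t : ℕ} (ht : t < T) : E.preLottery t ≤ mΩ :=
  (E.preLottery_le_hist ht).trans (E.hist.le _)

theorem hist_le_preLottery (E : Execution I ε T P) (t : ℕ) : E.hist t ≤ E.preLottery t :=
  le_sup_left

theorem measurable_user (E : Execution I ε T P) (t : ℕ) :
    Measurable[E.preLottery t] fun ω => (E.ctx t ω, E.click t ω, E.seen t ω) :=
  (comap_measurable _).mono le_sup_right le_rfl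

theorem measurable_ctx (E : Execution I ε T P) (t : ℕ) : Measurable[E.preLottery t] (E.ctx t) :=
  measurable_fst.comp (E.measurable_user t)

theorem measurable_click (E : Execution I ε T P) (t : ℕ) :
    Measurable[E.preLottery t] (E.click t) :=
  (measurable_fst.comp measurable_snd).comp (E.measurable_user t)

theorem measurable_seen (E : Execution I ε T P) (t : ℕ) :
    Measurable[E.preLottery t] (E.seen t) :=
  (measurable_snd.comp measurable_snd).comp (E.measurable_user t)

theorem measurableSet_genuineHit (E : Execution I ε T P) (t : ℕ) (h : Fin m) (a : Fin K) :
    MeasurableSet[E.preLottery t] {ω | I.expert h (E.ctx t ω) = a ∧ E.click t ω a = true} :=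
  MeasurableSet.inter
    (((I.expert_measurable h).comp (E.measurable_ctx t)) (measurableSet_singleton a))
    (((measurable_pi_apply a).comp (E.measurable_click t)) (measurableSet_singleton true))

theorem measurableSet_reportedHit (E : Execution I ε T P) (t : ℕ) (h : Fin m) (a : Fin K) :
    MeasurableSet[E.preLottery t] {ω | I.expert h (E.ctx t ω) = a ∧ E.seen t ω a = true} :=
  MeasurableSet.inter
    (((I.expert_measurable h).comp (E.measurable_ctx t)) (measurableSet_singleton a))
    (((measurable_pi_apply a).comp (E.measurable_seen t)) (measurableSet_singleton true))

theorem measurableSet_corrupted (E : Execution I ε T P) (t : ℕ) :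
    MeasurableSet[E.preLottery t] {ω | E.seen t ω ≠ E.click t ω} := by
  have : Measurable[E.preLottery t] fun ω => (E.seen t ω, E.click t ω) :=
    Measurable.prodMk (E.measurable_seen t) (E.measurable_click t)
  exact this (MeasurableSet.of_discrete (s := {p : (Fin K → Bool) × (Fin K → Bool) | p.1 ≠ p.2}))

theorem measurable_lottery (E : Execution I ε T P) (t : ℕ) :
    Measurable[MeasurableSpace.comap (fun ω => (E.explore t ω, E.draw t ω)) inferInstance]
      fun ω => (E.explore t ω, E.draw t ω) :=
  comap_measurable _

theorem measurableSet_lottery (E : Execution I ε T P) (t : ℕ) (b : Bool) (a : Fin K) :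
    MeasurableSet[MeasurableSpace.comap (fun ω => (E.explore t ω, E.draw t ω)) inferInstance]
      {ω | E.explore t ω = b ∧ E.draw t ω = a} := by
  have := E.measurable_lottery t (measurableSet_singleton (b, a))
  convert this using 1
  ext ω; simp

theorem comap_lottery_le (E : Execution I ε T P) {t : ℕ} (ht : t < T) :
    MeasurableSpace.comap (fun ω => (E.explore t ω, E.draw t ω)) inferInstance
      ≤ E.hist (t + 1) :=
  Measurable.comap_le (Measurable.prodMk (E.explore_measurable t ht) (E.draw_measurable t ht))

theorem measurableSet_explore_draw (E : Execution I ε T P) {t : ℕ} (ht : t < T) (b : Bool)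
    (a : Fin K) : MeasurableSet[E.hist (t + 1)] {ω | E.explore t ω = b ∧ E.draw t ω = a} :=
  E.comap_lottery_le ht _ (E.measurableSet_lottery t b a)

theorem measurableSet_explore (E : Execution I ε T P) {t : ℕ} (ht : t < T) (b : Bool) :
    MeasurableSet[E.hist (t + 1)] {ω | E.explore t ω = b} :=
  E.explore_measurable t ht (measurableSet_singleton b)

theorem integrable_mul_ite {p : Ω → Prop} [DecidablePred p] (hp : MeasurableSet {ω | p ω})
    {V : Ω → ℝ} (hV : Integrable V P) :
    Integrable (fun ω => V ω * (if p ω then (1 : ℝ) else 0)) P := by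
  refine (hV.indicator hp).congr (Filter.Eventually.of_forall fun ω => ?_)
  by_cases h : p ω <;> simp [Set.indicator, h]

/-- In round `t` the arm `a` is explored with probability `ε / K`, independently of everything
that precedes the lottery. -/
theorem integral_mul_explore_draw (E : Execution I ε T P) (hε : 0 ≤ ε) {t : ℕ} (ht : t < T)
    (a : Fin K) {V : Ω → ℝ} (hV : Measurable[E.preLottery t] V) :
    ∫ ω, V ω * (if E.explore t ω = true ∧ E.draw t ω = a then 1 else 0) ∂P
      = (∫ ω, V ω ∂P) * (ε / K) := by
  rw [integral_mul_of_indep (E.preLottery_le ht) ((E.comap_lottery_le ht).trans (E.hist.le _))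
    (E.lottery_indep t ht) hV (measurable_ite_one (E.measurableSet_lottery t true a)),
    integral_ite_one (E.hist.le _ _ (E.measurableSet_explore_draw ht true a)),
    measureReal_def, E.explore_law t ht a, ENNReal.toReal_ofReal (by positivity)]

theorem integral_mul_exploit_draw (E : Execution I ε T P) (hε : ε ≤ 1) {t : ℕ} (ht : t < T)
    (a : Fin K) {V : Ω → ℝ} (hV : Measurable[E.preLottery t] V) :
    ∫ ω, V ω * (if E.explore t ω = false ∧ E.draw t ω = a then 1 else 0) ∂P
      = (∫ ω, V ω ∂P) * ((1 - ε) / K) := by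
  have := sub_nonneg.2 hε
  rw [integral_mul_of_indep (E.preLottery_le ht) ((E.comap_lottery_le ht).trans (E.hist.le _))
    (E.lottery_indep t ht) hV (measurable_ite_one (E.measurableSet_lottery t false a)),
    integral_ite_one (E.hist.le _ _ (E.measurableSet_explore_draw ht false a)),
    measureReal_def, E.exploit_law t ht a, ENNReal.toReal_ofReal (by positivity)]

theorem ite_explore_eq_sum (E : Execution I ε T P) (t : ℕ) (b : Bool) (ω : Ω) :
    (if E.explore t ω = b then (1 : ℝ) else 0)
      = ∑ a, if E.explore t ω = b ∧ E.draw t ω = a then (1 : ℝ) else 0 := by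
  by_cases h : E.explore t ω = b <;> simp [h]

theorem integral_mul_explore (E : Execution I ε T P) (hK : 0 < K) (hε : 0 ≤ ε) {t : ℕ} (ht : t < T)
    {V : Ω → ℝ} (hV : Measurable[E.preLottery t] V) (hVi : Integrable V P) :
    ∫ ω, V ω * (if E.explore t ω = true then 1 else 0) ∂P = (∫ ω, V ω ∂P) * ε := by
  simp only [ite_explore_eq_sum, Finset.mul_sum]
  rw [integral_finsetSum _ fun a _ => integrable_mul_ite
    (E.hist.le _ _ (E.measurableSet_explore_draw ht true a)) hVi]
  simp only [E.integral_mul_explore_draw hε ht _ hV]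
  have : (K : ℝ) ≠ 0 := by positivity
  simp
  field_simp

theorem integral_mul_exploit (E : Execution I ε T P) (hK : 0 < K) (hε : ε ≤ 1) {t : ℕ} (ht : t < T)
    {V : Ω → ℝ} (hV : Measurable[E.preLottery t] V) (hVi : Integrable V P) :
    ∫ ω, V ω * (if E.explore t ω = false then 1 else 0) ∂P = (∫ ω, V ω ∂P) * (1 - ε) := by
  simp only [ite_explore_eq_sum, Finset.mul_sum]
  rw [integral_finsetSum _ fun a _ => integrable_mul_ite
    (E.hist.le _ _ (E.measurableSet_explore_draw ht false a)) hVi]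
  simp only [E.integral_mul_exploit_draw hε ht _ hV]
  have : (K : ℝ) ≠ 0 := by positivity
  simp
  field_simp

/-- Independently of the past, expert `h` picks `a` and the ad of `a` would be genuinely clicked
with probability `Π(a,h)`. -/
theorem integral_mul_genuineHit (E : Execution I ε T P) {t : ℕ} (ht : t < T)
    (a : Fin K) (h : Fin m) {V : Ω → ℝ} (hV : Measurable[E.hist t] V) :
    ∫ ω, V ω * (if I.expert h (E.ctx t ω) = a ∧ E.click t ω a = true then 1 else 0) ∂P
      = (∫ ω, V ω ∂P) * I.clickProb a h := by
  have hle : MeasurableSpace.comap (fun ω => (E.ctx t ω, E.click t ω)) inferInstance ≤ mΩ :=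
    (Measurable.comap_le (Measurable.prodMk (E.ctx_measurable t ht)
      (E.click_measurable t ht))).trans (E.hist.le _)
  have hcm : Measurable[MeasurableSpace.comap (fun ω => (E.ctx t ω, E.click t ω)) inferInstance]
      fun ω => (E.ctx t ω, E.click t ω) := comap_measurable _
  have hset : MeasurableSet[MeasurableSpace.comap (fun ω => (E.ctx t ω, E.click t ω))
      inferInstance] {ω | I.expert h (E.ctx t ω) = a ∧ E.click t ω a = true} :=
    MeasurableSet.inter
      (((I.expert_measurable h).comp (measurable_fst.comp hcm)) (measurableSet_singleton a))
      ((((measurable_pi_apply a).comp measurable_snd).comp hcm) (measurableSet_singleton true))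
  rw [integral_mul_of_indep (E.hist.le t) hle (E.user_indep t ht) hV (measurable_ite_one hset),
    integral_ite_one (hle _ hset), measureReal_def]
  congr 1
  have hB : MeasurableSet {x | I.expert h x = a} :=
    I.expert_measurable h (measurableSet_singleton a)
  have hlaw : P {ω | I.expert h (E.ctx t ω) = a ∧ E.click t ω a = true}
      = ∫⁻ x in {x | I.expert h x = a}, ENNReal.ofReal (I.ctr a x) ∂I.ctxLaw :=
    E.click_law t ht a {x | I.expert h x = a} hB
  rw [hlaw]
  rw [← ofReal_integral_eq_lintegral_ofReal, ENNReal.toReal_ofReal]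
  · rw [← integral_indicator hB, PPCInstance.clickProb]
    refine integral_congr_ae (Filter.Eventually.of_forall fun x => ?_)
    by_cases hx : I.expert h x = a <;> simp [Set.indicator, hx]
  · exact integral_nonneg fun x => (I.ctr_mem a x).1
  · have := I.isProb
    exact (integrable_of_abs_le (I.ctr_measurable a) 1 fun x => by
      rw [abs_of_nonneg (I.ctr_mem a x).1]; exact (I.ctr_mem a x).2).integrableOn
  · exact Filter.Eventually.of_forall fun x => (I.ctr_mem a x).1

end Execution

/-! ### Concentration of the explored data -/

namespace Execution

variable {X : Type*} [MeasurableSpace X] {K m : ℕ} {I : PPCInstance X K m} {ε : ℝ} {T : ℕ}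
  {Ω : Type*} [mΩ : MeasurableSpace Ω] {P : Measure Ω}

/-- The number of explore rounds `τ < t` with `h(x^τ) = a`, `a^τ = a` and a genuine click. -/
def genuineHits (E : Execution I ε T P) (t : ℕ) (ω : Ω) (a : Fin K) (h : Fin m) : ℕ :=
  ((Finset.range t).filter fun τ => E.explore τ ω = true ∧ I.expert h (E.ctx τ ω) = a ∧
    E.draw τ ω = a ∧ E.click τ ω a = true).card

/-- The number of corrupted rounds `τ < t` in which arm `a` is explored. -/
def corruptedDraws (E : Execution I ε T P) (t : ℕ) (ω : Ω) (a : Fin K) : ℕ :=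
  ((Finset.range t).filter fun τ => (E.explore τ ω = true ∧ E.draw τ ω = a) ∧
    E.seen τ ω ≠ E.click τ ω).card

/-- At least half of the expected number of explore rounds occurs with high probability. -/
theorem measureReal_numExplore_le [IsProbabilityMeasure P] (E : Execution I ε T P) (hK : 0 < K)
    (hε : 0 ≤ ε) {t : ℕ} (ht : t ≤ T) :
    P.real {ω | (E.numExplore t ω : ℝ) ≤ ε * t / 2}
      ≤ Real.exp (-(ε * t / 2 * (1 - Real.log 2))) := by
  let Z : ℕ → Ω → ℝ := fun τ ω => ε / 2 - Real.log 2 * (if E.explore τ ω = true then 1 else 0)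
  have hlog : 0 < Real.log 2 := Real.log_pos one_lt_two
  have hm : ∀ τ < T, Measurable[E.hist (τ + 1)] (Z τ) := fun τ hτ =>
    measurable_const.sub (measurable_const.mul (measurable_ite_one (E.measurableSet_explore hτ true)))
  refine le_trans (measureReal_mono fun ω hω => ?_)
    (measureReal_le_sum_le_exp_neg (Z := Z) (B := ε / 2) hm (fun τ _ ω => ?_)
      (fun τ hτ V hV hV0 ⟨M, hM⟩ => ?_) ht _)
  · have hω : (E.numExplore t ω : ℝ) ≤ ε * t / 2 := hω
    change ε * t / 2 * (1 - Real.log 2) ≤ _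
    have : ∑ τ ∈ Finset.range t, Z τ ω = ε * t / 2 - Real.log 2 * E.numExplore t ω := by
      simp only [Z, Finset.sum_sub_distrib, ← Finset.mul_sum, Finset.sum_boole, numExplore]
      simp
      ring
    rw [this]
    nlinarith
  · simp only [Z]
    split_ifs <;> linarith
  · have hVi : Integrable V P := integrable_of_abs_le (hV.mono (E.hist.le τ) le_rfl) M fun ω => by
      rw [abs_of_nonneg (hV0 ω)]; exact hM ω
    have e : ∀ ω, V ω * Real.exp (Z τ ω) = Real.exp (ε / 2) *
        (V ω - V ω * (if E.explore τ ω = true then 1 else 0) * (1 / 2)) := by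
      intro ω
      simp only [Z, Real.exp_sub]
      split_ifs
      · rw [mul_one, Real.exp_log two_pos]; ring
      · simp; ring
    simp only [e]
    rw [integral_const_mul, integral_sub hVi
      ((integrable_mul_ite (E.hist.le _ _ (E.measurableSet_explore hτ true)) hVi).mul_const _),
      integral_mul_const, E.integral_mul_explore hK hε hτ (hV.mono (E.hist_le_preLottery τ) le_rfl) hVi]
    have h1 : 1 - ε / 2 ≤ Real.exp (-(ε / 2)) := by
      have := Real.add_one_le_exp (-(ε / 2)); linarith
    have h2 : Real.exp (ε / 2) * (1 - ε / 2) ≤ 1 := by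
      calc _ ≤ Real.exp (ε / 2) * Real.exp (-(ε / 2)) :=
            mul_le_mul_of_nonneg_left h1 (Real.exp_pos _).le
        _ = 1 := by rw [← Real.exp_add]; simp
    have h3 : 0 ≤ ∫ ω, V ω ∂P := integral_nonneg hV0
    nlinarith

/-- The adversary commits to a corruption before the lottery is drawn, so that only a fraction of
about `ε / K` of the corrupted rounds hits an exploration of arm `a`. The term `6 K log T / ε` in
`C'` brings the failure probability down to `T⁻²`. -/
theorem measureReal_le_corruptedDraws [IsProbabilityMeasure P] (E : Execution I ε T P)
    (hK : 0 < K) (hε : 0 < ε) {C : ℝ} (hC : 0 ≤ C) (hE : E.CorruptedAtMost C) (a : Fin K)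
    {t : ℕ} (ht : t ≤ T) :
    P.real {ω | ε / K * corruptionTerm K T ε C ≤ E.corruptedDraws t ω a}
      ≤ Real.exp (-(2 * Real.log T)) := by
  let Z : ℕ → Ω → ℝ := fun τ ω => (if E.seen τ ω ≠ E.click τ ω then 1 else 0) *
    (Real.log 2 * (if E.explore τ ω = true ∧ E.draw τ ω = a then 1 else 0) - ε / K)
  have hK' : (0 : ℝ) < K := by exact_mod_cast hK
  have hc : 0 < ε / K := by positivity
  have hlog : 0 < Real.log 2 := Real.log_pos one_lt_two
  have hm : ∀ τ < T, Measurable[E.hist (τ + 1)] (Z τ) := fun τ hτ =>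
    (measurable_ite_one (E.preLottery_le_hist hτ _ (E.measurableSet_corrupted τ))).mul
      ((measurable_const.mul (measurable_ite_one (E.measurableSet_explore_draw hτ true a))).sub
        measurable_const)
  have hlt := Real.log_two_gt_d9
  refine le_trans ?_ (measureReal_le_sum_le_exp_neg (P := P) (Z := Z) (B := Real.log 2) hm
    (fun τ _ ω => ?_) (fun τ hτ V hV hV0 ⟨M, hM⟩ => ?_) ht (2 * Real.log T))
  · refine ENNReal.toReal_mono (measure_ne_top _ _) (measure_mono_ae ?_)
    filter_upwards [hE] with ω hω h
    have h : ε / K * corruptionTerm K T ε C ≤ E.corruptedDraws t ω a := h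
    change 2 * Real.log T ≤ _
    have hN : (((Finset.range t).filter fun τ => E.seen τ ω ≠ E.click τ ω).card : ℝ) ≤ C := by
      refine le_trans ?_ hω
      exact_mod_cast Finset.card_le_card (Finset.filter_subset_filter _ (Finset.range_mono ht))
    have : ∑ τ ∈ Finset.range t, Z τ ω = Real.log 2 * E.corruptedDraws t ω a
        - ε / K * ((Finset.range t).filter fun τ => E.seen τ ω ≠ E.click τ ω).card := by
      simp only [corruptedDraws, ← Finset.sum_boole, Finset.mul_sum, ← Finset.sum_sub_distrib]
      refine Finset.sum_congr rfl fun τ _ => ?_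
      simp only [Z]
      by_cases h1 : E.seen τ ω = E.click τ ω <;>
        by_cases h2 : E.explore τ ω = true ∧ E.draw τ ω = a <;> simp [h1, h2]
    rw [this]
    -- with `ν = ε C / K` and `D' = ε D / K ≥ max ν (6 log T)`, the exponent is at least
    -- `log 2 * (ν + D') - ν ≥ (2 * log 2 - 1) * D' ≥ 2 * log T`
    set D := max C (6 * K * Real.log T / ε)
    have hD1 : ε / K * C ≤ ε / K * D := mul_le_mul_of_nonneg_left (le_max_left _ _) hc.le
    have hD2 : 6 * Real.log T ≤ ε / K * D := by
      calc 6 * Real.log T = ε / K * (6 * K * Real.log T / ε) := by field_simp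
        _ ≤ _ := mul_le_mul_of_nonneg_left (le_max_right _ _) hc.le
    have hN' := mul_le_mul_of_nonneg_left hN hc.le
    have h' : ε / K * C + ε / K * D ≤ E.corruptedDraws t ω a := by
      rw [← mul_add]; exact h
    have hν : 0 ≤ ε / K * C := by positivity
    have h'' := mul_le_mul_of_nonneg_left h' hlog.le
    nlinarith
  · simp only [Z]
    split_ifs <;> simp <;> linarith
  · have hVi : Integrable V P := integrable_of_abs_le (hV.mono (E.hist.le τ) le_rfl) M fun ω => by
      rw [abs_of_nonneg (hV0 ω)]; exact hM ω
    have hcm := E.measurableSet_corrupted τ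
    have hcm' := E.preLottery_le hτ _ hcm
    have hWi : Integrable (fun ω => V ω * (if E.seen τ ω ≠ E.click τ ω then (1 : ℝ) else 0)) P :=
      integrable_mul_ite hcm' hVi
    have hWm : Measurable[E.preLottery τ]
        (fun ω => V ω * (if E.seen τ ω ≠ E.click τ ω then (1 : ℝ) else 0)) :=
      (hV.mono (E.hist_le_preLottery τ) le_rfl).mul (measurable_ite_one hcm)
    have e : ∀ ω, V ω * Real.exp (Z τ ω) = (V ω +
        V ω * (if E.seen τ ω ≠ E.click τ ω then 1 else 0) * (Real.exp (-(ε / K)) - 1)) +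
        V ω * (if E.seen τ ω ≠ E.click τ ω then 1 else 0) *
          (if E.explore τ ω = true ∧ E.draw τ ω = a then 1 else 0) * Real.exp (-(ε / K)) := by
      intro ω
      simp only [Z]
      by_cases h1 : E.seen τ ω = E.click τ ω
      · simp [h1]
      · by_cases h2 : E.explore τ ω = true ∧ E.draw τ ω = a
        · simp only [h1, h2, ne_eq, not_false_eq_true, if_true, and_self, one_mul, mul_one,
            sub_eq_add_neg, Real.exp_add, Real.exp_log two_pos]
          ring
        · simp only [h1, h2, ne_eq, not_false_eq_true, if_true, if_false]
          rw [one_mul, mul_zero, zero_sub]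
          ring
    simp only [e]
    rw [integral_add_mul_add_mul hVi hWi (integrable_mul_ite
        (E.hist.le _ _ (E.measurableSet_explore_draw hτ true a)) hWi),
      E.integral_mul_explore_draw hε.le hτ a hWm]
    have h1 : 1 + ε / K ≤ Real.exp (ε / K) := by
      have := Real.add_one_le_exp (ε / K); linarith
    have h2 : Real.exp (-(ε / K)) * (1 + ε / K) ≤ 1 := by
      calc _ ≤ Real.exp (-(ε / K)) * Real.exp (ε / K) :=
            mul_le_mul_of_nonneg_left h1 (Real.exp_pos _).le
        _ = 1 := by rw [← Real.exp_add]; simp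
    have h3 : 0 ≤ ∫ ω, V ω * (if E.seen τ ω ≠ E.click τ ω then (1 : ℝ) else 0) ∂P :=
      integral_nonneg fun ω => mul_nonneg (hV0 ω) (by split_ifs <;> simp)
    nlinarith

/-- The reward that exploration of round `t` yields for expert `h` when a genuine click on arm `a`
is worth `w a`. -/
def exploredReward (E : Execution I ε T P) (w : Fin K → ℝ) (h : Fin m) (t : ℕ) (ω : Ω) : ℝ :=
  ∑ a, w a * ((if I.expert h (E.ctx t ω) = a ∧ E.click t ω a = true then 1 else 0) *
    (if E.explore t ω = true ∧ E.draw t ω = a then 1 else 0))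

theorem exploredReward_eq (E : Execution I ε T P) (w : Fin K → ℝ) (h : Fin m) (t : ℕ) (ω : Ω) :
    E.exploredReward w h t ω = if E.explore t ω = true ∧ I.expert h (E.ctx t ω) = E.draw t ω ∧
      E.click t ω (E.draw t ω) = true then w (E.draw t ω) else 0 := by
  unfold exploredReward
  rw [Finset.sum_eq_single (E.draw t ω)]
  · by_cases h1 : E.explore t ω = true <;>
      by_cases h2 : I.expert h (E.ctx t ω) = E.draw t ω ∧ E.click t ω (E.draw t ω) = true <;>
      simp [h1, h2]
  · intro b _ hb
    simp [hb.symm]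
  · simp

theorem sum_exploredReward (E : Execution I ε T P) (w : Fin K → ℝ) (h : Fin m) (t : ℕ) (ω : Ω) :
    ∑ τ ∈ Finset.range t, E.exploredReward w h τ ω = ∑ a, w a * (E.genuineHits t ω a h : ℝ) := by
  unfold exploredReward genuineHits
  rw [Finset.sum_comm]
  refine Finset.sum_congr rfl fun a _ => ?_
  rw [← Finset.mul_sum, ← Finset.sum_boole]
  congr 1
  refine Finset.sum_congr rfl fun τ _ => ?_
  by_cases h1 : E.explore τ ω = true <;> by_cases h2 : I.expert h (E.ctx τ ω) = a <;>
    by_cases h3 : E.draw τ ω = a <;> simp [h1, h2, h3]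

theorem measurable_exploredReward (E : Execution I ε T P) (w : Fin K → ℝ) (h : Fin m) {t : ℕ}
    (ht : t < T) : Measurable[E.hist (t + 1)] (E.exploredReward w h t) :=
  Finset.measurable_sum _ fun a _ => measurable_const.mul
    ((measurable_ite_one (E.preLottery_le_hist ht _ (E.measurableSet_genuineHit t h a))).mul
      (measurable_ite_one (E.measurableSet_explore_draw ht true a)))

theorem integral_mul_exploredReward (E : Execution I ε T P) (hε : 0 ≤ ε) (w : Fin K → ℝ)
    (h : Fin m) {t : ℕ} (ht : t < T) {V : Ω → ℝ} (hV : Measurable[E.hist t] V)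
    (hVi : Integrable V P) :
    ∫ ω, V ω * E.exploredReward w h t ω ∂P
      = (∫ ω, V ω ∂P) * (ε * ((∑ a, w a * I.clickProb a h) / K)) := by
  have e : ∀ ω, V ω * E.exploredReward w h t ω = ∑ a, w a * (V ω *
      (if I.expert h (E.ctx t ω) = a ∧ E.click t ω a = true then 1 else 0) *
      (if E.explore t ω = true ∧ E.draw t ω = a then 1 else 0)) := by
    intro ω
    rw [exploredReward, Finset.mul_sum]
    exact Finset.sum_congr rfl fun a _ => by ring
  simp only [e]
  have hi : ∀ a, Integrable (fun ω => V ω *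
      (if I.expert h (E.ctx t ω) = a ∧ E.click t ω a = true then (1 : ℝ) else 0)) P := fun a =>
    integrable_mul_ite (E.preLottery_le ht _ (E.measurableSet_genuineHit t h a)) hVi
  rw [integral_finsetSum _ fun a _ => (integrable_mul_ite
    (E.hist.le _ _ (E.measurableSet_explore_draw ht true a)) (hi a)).const_mul _]
  rw [Finset.sum_div, Finset.mul_sum, Finset.mul_sum]
  refine Finset.sum_congr rfl fun a _ => ?_
  have hm : Measurable[E.preLottery t] (fun ω => V ω *
      (if I.expert h (E.ctx t ω) = a ∧ E.click t ω a = true then (1 : ℝ) else 0)) :=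
    (hV.mono (E.hist_le_preLottery t) le_rfl).mul
      (measurable_ite_one (E.measurableSet_genuineHit t h a))
  rw [integral_const_mul, E.integral_mul_explore_draw hε ht a hm,
    E.integral_mul_genuineHit ht a h hV]
  ring

/-- Hoeffding's bound for the genuine explored rewards of expert `h`, on the exponential scale and
with the random number of explore rounds in place of a deterministic sample size. -/
theorem measureReal_le_sum_exploredReward [IsProbabilityMeasure P] (E : Execution I ε T P)
    (hK : 0 < K) (hε : 0 ≤ ε) {w : Fin K → ℝ} (hw0 : ∀ a, 0 ≤ w a)
    (hw1 : ∀ a, w a ≤ 1) (h : Fin m) (l x : ℝ) {t : ℕ} (ht : t ≤ T) :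
    P.real {ω | x ≤ l * (∑ a, w a * (E.genuineHits t ω a h : ℝ)
        - E.numExplore t ω * ((∑ a, w a * I.clickProb a h) / K)) - E.numExplore t ω * (l ^ 2 / 8)}
      ≤ Real.exp (-x) := by
  set q : ℝ := (∑ a, w a * I.clickProb a h) / K with hq
  have hK' : (1 : ℝ) ≤ K := by exact_mod_cast hK
  have hq0 : 0 ≤ q := div_nonneg
    (Finset.sum_nonneg fun a _ => mul_nonneg (hw0 a) (I.clickProb_nonneg a h)) (by linarith)
  have hq1 : q ≤ 1 := by
    rw [hq, div_le_one (by linarith)]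
    exact (I.sum_mul_clickProb_le_one hw0 hw1 h).trans hK'
  let Z : ℕ → Ω → ℝ := fun τ ω => l * E.exploredReward w h τ ω
    - (if E.explore τ ω = true then 1 else 0) * (l * q + l ^ 2 / 8)
  have hm : ∀ τ < T, Measurable[E.hist (τ + 1)] (Z τ) := fun τ hτ =>
    (measurable_const.mul (E.measurable_exploredReward w h hτ)).sub
      ((measurable_ite_one (E.measurableSet_explore hτ true)).mul measurable_const)
  have hY : ∀ τ ω, 0 ≤ E.exploredReward w h τ ω ∧ E.exploredReward w h τ ω ≤ 1 := fun τ ω => by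
    rw [exploredReward_eq]
    split_ifs
    · exact ⟨hw0 _, hw1 _⟩
    · exact ⟨le_rfl, zero_le_one⟩
  refine le_trans (measureReal_mono fun ω hω => ?_)
    (measureReal_le_sum_le_exp_neg (Z := Z) (B := |l| + |l * q + l ^ 2 / 8|) hm (fun τ _ ω => ?_)
      (fun τ hτ V hV hV0 ⟨M, hM⟩ => ?_) ht _)
  · have hω : x ≤ _ := hω
    change x ≤ _
    refine hω.trans (le_of_eq ?_)
    simp only [Z, Finset.sum_sub_distrib, ← Finset.mul_sum, ← Finset.sum_mul, Finset.sum_boole,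
      sum_exploredReward, numExplore]
    ring
  · have h1 : l * E.exploredReward w h τ ω ≤ |l| := by
      calc _ ≤ |l| * E.exploredReward w h τ ω :=
            mul_le_mul_of_nonneg_right (le_abs_self l) (hY τ ω).1
        _ ≤ |l| * 1 := mul_le_mul_of_nonneg_left (hY τ ω).2 (abs_nonneg l)
        _ = _ := mul_one _
    have h2 := neg_abs_le (l * q + l ^ 2 / 8)
    have h3 := abs_nonneg (l * q + l ^ 2 / 8)
    simp only [Z]
    split_ifs <;> linarith
  · have hVi : Integrable V P := integrable_of_abs_le (hV.mono (E.hist.le τ) le_rfl) M fun ω => by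
      rw [abs_of_nonneg (hV0 ω)]; exact hM ω
    set c : ℝ := Real.exp (-(l * q + l ^ 2 / 8)) with hc
    -- linearise the exponential in the reward, which vanishes outside explore rounds
    have e : ∀ ω, V ω * Real.exp (Z τ ω) ≤ (V ω +
        V ω * (if E.explore τ ω = true then 1 else 0) * (c - 1)) +
        V ω * E.exploredReward w h τ ω * (c * (Real.exp l - 1)) := by
      intro ω
      by_cases h1 : E.explore τ ω = true
      · have h2 := exp_mul_le_one_add (hY τ ω).1 (hY τ ω).2 l
        have h3 : Real.exp (Z τ ω) = c * Real.exp (l * E.exploredReward w h τ ω) := by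
          simp only [Z, h1, if_true, hc, ← Real.exp_add]
          congr 1; ring
        have h4 := mul_le_mul_of_nonneg_left h2 (mul_nonneg (hV0 ω) (Real.exp_pos _).le : 0 ≤ V ω * c)
        rw [h3]
        simp only [h1, if_true]
        linarith
      · have : E.exploredReward w h τ ω = 0 := by rw [exploredReward_eq]; simp [h1]
        simp [Z, h1, this]
    have hVE : Integrable (fun ω => V ω * E.exploredReward w h τ ω) P :=
      integrable_of_abs_le ((hV.mono (E.hist.le τ) le_rfl).mul
        ((E.measurable_exploredReward w h hτ).mono (E.hist.le _) le_rfl)) M fun ω => by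
          rw [abs_of_nonneg (mul_nonneg (hV0 ω) (hY τ ω).1)]
          have := hV0 ω; have := hM ω; have := hY τ ω
          nlinarith
    have hV1 := integrable_mul_ite (E.hist.le _ _ (E.measurableSet_explore hτ true)) hVi
    refine (integral_mono_of_nonneg (μ := P)
      (Filter.Eventually.of_forall fun ω => mul_nonneg (hV0 ω) (Real.exp_pos (Z τ ω)).le)
      ((hVi.add (hV1.mul_const (c - 1))).add (hVE.mul_const (c * (Real.exp l - 1))))
      (Filter.Eventually.of_forall e)).trans
      ((integral_add_mul_add_mul hVi hV1 hVE (c - 1) (c * (Real.exp l - 1))).trans_le ?_)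
    rw [E.integral_mul_exploredReward hε w h hτ hV hVi,
      E.integral_mul_explore hK hε hτ (hV.mono (E.hist_le_preLottery τ) le_rfl) hVi]
    have h2 : c * (1 + q * (Real.exp l - 1)) ≤ 1 := by
      calc _ ≤ c * Real.exp (l * q + l ^ 2 / 8) :=
            mul_le_mul_of_nonneg_left (one_add_mul_exp_sub_one_le hq0 hq1 l) (Real.exp_pos _).le
        _ = 1 := by rw [hc, ← Real.exp_add]; simp
    have h3 : 0 ≤ ∫ ω, V ω ∂P := integral_nonneg hV0
    have h4 := mul_le_mul_of_nonneg_left h2 (mul_nonneg h3 hε)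
    rw [← hq]
    linarith

end Execution

/-! ### Truthfulness of the payment rule -/

namespace GreedyRule

variable {K m : ℕ}

theorem sum_mul_update (Q : Fin K → ℝ) (b : Fin K → ℝ) (a : Fin K) (y : ℝ) :
    ∑ i, Q i * Function.update b a y i = ∑ i, Q i * b i + Q a * (y - b a) := by
  rw [← sub_eq_iff_eq_add', ← Finset.sum_sub_distrib, Finset.sum_eq_single a]
  · simp; ring
  · intro i _ hi
    simp [Function.update_of_ne hi]
  · simp

/-- A higher bid never lowers the estimated click probability, whatever the tie-breaking. -/
theorem monotone_gHat (G : GreedyRule K m) (Q : Fin K → Fin m → ℝ) (b : Fin K → ℝ) (a : Fin K) :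
    Monotone (G.gHat Q b a) := by
  intro y z hyz
  rcases hyz.eq_or_lt with rfl | hyz
  · exact le_rfl
  have h1 := G.isMax Q (Function.update b a y) (G.expertAt Q b a z)
  have h2 := G.isMax Q (Function.update b a z) (G.expertAt Q b a y)
  simp only [expertAt, sum_mul_update (fun i => Q i _)] at h1 h2
  simp only [gHat, expertAt]
  nlinarith

theorem gHat_nonneg (G : GreedyRule K m) {Q : Fin K → Fin m → ℝ} (b : Fin K → ℝ) (a : Fin K)
    (hQ : ∀ h, 0 ≤ Q a h) (y : ℝ) : 0 ≤ G.gHat Q b a y := hQ _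

theorem intervalIntegrable_gHat (G : GreedyRule K m) (Q : Fin K → Fin m → ℝ) (b : Fin K → ℝ)
    (a : Fin K) (x y : ℝ) : IntervalIntegrable (G.gHat Q b a) volume x y :=
  (G.monotone_gHat Q b a).intervalIntegrable

theorem integral_gHat_nonneg (G : GreedyRule K m) {Q : Fin K → Fin m → ℝ} (b : Fin K → ℝ)
    (a : Fin K) (hQ : ∀ h, 0 ≤ Q a h) {y : ℝ} (hy : 0 ≤ y) :
    0 ≤ ∫ z in (0 : ℝ)..y, G.gHat Q b a z :=
  intervalIntegral.integral_nonneg hy fun z _ => G.gHat_nonneg b a hQ z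

theorem integral_gHat_le (G : GreedyRule K m) (Q : Fin K → Fin m → ℝ) (b : Fin K → ℝ)
    (a : Fin K) {x y : ℝ} (hxy : x ≤ y) :
    ∫ z in x..y, G.gHat Q b a z ≤ (y - x) * G.gHat Q b a y := by
  have := intervalIntegral.integral_mono_on hxy (G.intervalIntegrable_gHat Q b a x y)
    (intervalIntegrable_const (c := G.gHat Q b a y)) fun z hz => G.monotone_gHat Q b a hz.2
  simpa using this

theorem le_integral_gHat (G : GreedyRule K m) (Q : Fin K → Fin m → ℝ) (b : Fin K → ℝ)
    (a : Fin K) {x y : ℝ} (hxy : x ≤ y) :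
    (y - x) * G.gHat Q b a x ≤ ∫ z in x..y, G.gHat Q b a z := by
  have := intervalIntegral.integral_mono_on hxy (intervalIntegrable_const (c := G.gHat Q b a x))
    (G.intervalIntegrable_gHat Q b a x y) fun z hz => G.monotone_gHat Q b a hz.1
  simpa using this

/-- The expected payment per round is `y ĝ(y) - ∫₀^y ĝ`, also where `ĝ(y) = 0`. -/
theorem price_mul_gHat (G : GreedyRule K m) {Q : Fin K → Fin m → ℝ} (b : Fin K → ℝ) (a : Fin K)
    (hQ : ∀ h, 0 ≤ Q a h) {y : ℝ} (hy : 0 ≤ y) :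
    G.price Q b a y * G.gHat Q b a y = y * G.gHat Q b a y - ∫ z in (0 : ℝ)..y, G.gHat Q b a z := by
  by_cases h : 0 < G.gHat Q b a y
  · rw [price, if_pos h, sub_mul, div_mul_cancel₀ _ h.ne']
  · have h0 : G.gHat Q b a y = 0 := le_antisymm (not_lt.1 h) (G.gHat_nonneg b a hQ y)
    have h1 := G.integral_gHat_nonneg b a hQ hy
    have h2 := G.integral_gHat_le Q b a hy
    rw [h0] at h2 ⊢
    linarith

theorem price_mem_Icc (G : GreedyRule K m) {Q : Fin K → Fin m → ℝ} (b : Fin K → ℝ) (a : Fin K)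
    (hQ : ∀ h, 0 ≤ Q a h) {y : ℝ} (hy : 0 ≤ y) : G.price Q b a y ∈ Set.Icc 0 y := by
  by_cases h : 0 < G.gHat Q b a y
  · have h1 := G.integral_gHat_nonneg b a hQ hy
    have h2 := G.integral_gHat_le Q b a hy
    rw [price, if_pos h]
    refine ⟨sub_nonneg.2 ?_, sub_le_self _ (div_nonneg h1 h.le)⟩
    rw [div_le_iff₀ h]
    simpa using h2
  · rw [price, if_neg h]
    exact ⟨le_rfl, hy⟩

/-- With respect to the estimated click probabilities, truthful bidding is optimal. -/
theorem estimated_utility_le (G : GreedyRule K m) {Q : Fin K → Fin m → ℝ} (b : Fin K → ℝ)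
    (a : Fin K) (hQ : ∀ h, 0 ≤ Q a h) {v y : ℝ} (hv : 0 ≤ v) (hy : 0 ≤ y) :
    (v - G.price Q b a y) * G.gHat Q b a y ≤ (v - G.price Q b a v) * G.gHat Q b a v := by
  rw [sub_mul, sub_mul, G.price_mul_gHat b a hQ hy, G.price_mul_gHat b a hQ hv]
  have hadd := intervalIntegral.integral_add_adjacent_intervals
    (G.intervalIntegrable_gHat Q b a 0 y) (G.intervalIntegrable_gHat Q b a y v)
  rcases le_total y v with h | h
  · have := G.le_integral_gHat Q b a h
    linarith
  · have := G.integral_gHat_le Q b a h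
    rw [intervalIntegral.integral_symm] at this
    linarith

/-- If the click probabilities of agent `a` are known up to `δ`, then a false bid gains at most
`2 δ`. -/
theorem utility_sub_utility_le {X : Type*} [MeasurableSpace X] (G : GreedyRule K m)
    (I : PPCInstance X K m) {Q : Fin K → Fin m → ℝ} (b : Fin K → ℝ) (a : Fin K)
    (hQ : ∀ h, 0 ≤ Q a h) {δ : ℝ} (hδ : ∀ h, |Q a h - I.clickProb a h| ≤ δ) {y : ℝ}
    (hy : y ∈ Set.Icc (0 : ℝ) 1) :
    G.utility I Q b a y - G.utility I Q b a (I.value a) ≤ 2 * δ := by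
  have hv := I.value_mem a
  have key : ∀ z ∈ Set.Icc (0 : ℝ) 1,
      |G.utility I Q b a z - (I.value a - G.price Q b a z) * G.gHat Q b a z| ≤ δ := by
    intro z hz
    have hp := G.price_mem_Icc b a hQ hz.1
    have h1 : |I.value a - G.price Q b a z| ≤ 1 :=
      abs_le.2 ⟨by linarith [hv.1, hp.2, hz.2], by linarith [hv.2, hp.1]⟩
    rw [utility, gHat, ← mul_sub, abs_mul, abs_sub_comm (I.clickProb _ _)]
    calc _ ≤ 1 * δ := mul_le_mul h1 (hδ _) (abs_nonneg _) zero_le_one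
      _ = δ := one_mul δ
  have h1 := (abs_le.1 (key y hy)).2
  have h2 := (abs_le.1 (key _ hv)).1
  have h3 := G.estimated_utility_le b a hQ hv.1 hy.1
  linarith

/-- If all agents bid truthfully and the estimated welfare of every expert is correct up to `η`,
then the greedy choice loses at most `2 η`. -/
theorem bestWelfare_sub_welfare_le {X : Type*} [MeasurableSpace X] (G : GreedyRule K m)
    (I : PPCInstance X K m) {Q : Fin K → Fin m → ℝ} {η : ℝ}
    (hη : ∀ h, |∑ a, I.value a * Q a h - ∑ a, I.value a * I.clickProb a h| ≤ η) :
    I.bestWelfare - I.welfare (G.choose Q I.value) ≤ 2 * η := by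
  have : Nonempty (Fin m) := ⟨G.choose Q I.value⟩
  rw [sub_le_iff_le_add]
  refine ciSup_le fun h => ?_
  have h1 := (abs_le.1 (hη h)).1
  have h2 := (abs_le.1 (hη (G.choose Q I.value))).2
  have h3 := G.isMax Q I.value h
  simp only [mul_comm (Q _ _)] at h3
  rw [I.welfare_eq_sum, I.welfare_eq_sum]
  linarith

end GreedyRule

/-! ### Accuracy of the estimates -/

namespace Execution

variable {X : Type*} [MeasurableSpace X] {K m : ℕ} {I : PPCInstance X K m} {ε : ℝ} {T : ℕ}
  {Ω : Type*} [mΩ : MeasurableSpace Ω] {P : Measure Ω}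

theorem estimate_nonneg (E : Execution I ε T P) (t : ℕ) (ω : Ω) (a : Fin K) (h : Fin m) :
    0 ≤ E.estimate t ω a h := by
  unfold estimate; positivity

theorem abs_numHits_sub_genuineHits_le (E : Execution I ε T P) (t : ℕ) (ω : Ω) (a : Fin K)
    (h : Fin m) :
    |(E.numHits t ω a h : ℝ) - E.genuineHits t ω a h| ≤ E.corruptedDraws t ω a := by
  simp only [numHits, genuineHits, corruptedDraws, ← Finset.sum_boole, ← Finset.sum_sub_distrib]
  refine (Finset.abs_sum_le_sum_abs _ _).trans (Finset.sum_le_sum fun τ _ => ?_)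
  by_cases h1 : E.seen τ ω = E.click τ ω
  · simp [h1]
  · by_cases h2 : E.explore τ ω = true <;> by_cases h3 : I.expert h (E.ctx τ ω) = a <;>
      by_cases h4 : E.draw τ ω = a <;> by_cases h5 : E.seen τ ω a = true <;>
      by_cases h6 : E.click τ ω a = true <;> simp [h1, h2, h3, h4, h5, h6]

/-- The error of the weighted estimates is at most the sampling error `K s` plus a bias of at most
`d` per unit of weight, caused by the corrupted explore rounds. -/
theorem abs_sum_estimate_sub_le (E : Execution I ε T P) {t : ℕ} {ω : Ω} {w : Fin K → ℝ}
    (hw0 : ∀ a, 0 ≤ w a) {h : Fin m} {s d : ℝ}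
    (hn : 0 < (E.numExplore t ω : ℝ))
    (hs : |∑ a, w a * (E.genuineHits t ω a h : ℝ)
      - E.numExplore t ω * ((∑ a, w a * I.clickProb a h) / K)| ≤ s * E.numExplore t ω)
    (hd : ∀ a, (K : ℝ) * E.corruptedDraws t ω a ≤ d * E.numExplore t ω) :
    |∑ a, w a * E.estimate t ω a h - ∑ a, w a * I.clickProb a h| ≤ K * s + (∑ a, w a) * d := by
  set n := (E.numExplore t ω : ℝ) with hndef
  rcases Nat.eq_zero_or_pos K with rfl | hK
  · simp
  have hK' : (0 : ℝ) < K := by exact_mod_cast hK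
  have e : ∑ a, w a * E.estimate t ω a h - ∑ a, w a * I.clickProb a h
      = ((K : ℝ) / n) * (∑ a, w a * (E.genuineHits t ω a h : ℝ)
        - n * ((∑ a, w a * I.clickProb a h) / K))
      + ∑ a, w a * ((K / n) * ((E.numHits t ω a h : ℝ) - E.genuineHits t ω a h)) := by
    have e1 : ((K : ℝ) / n) * (n * ((∑ a, w a * I.clickProb a h) / K))
        = ∑ a, w a * I.clickProb a h := by field_simp
    rw [mul_sub, e1, Finset.mul_sum, sub_add_eq_add_sub, ← Finset.sum_add_distrib]
    congr 1
    refine Finset.sum_congr rfl fun a _ => ?_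
    rw [estimate, ← hndef]
    ring
  have hKn : 0 < (K : ℝ) / n := div_pos hK' hn
  rw [e]
  refine (abs_add_le _ _).trans (add_le_add ?_ ?_)
  · rw [abs_mul, abs_of_pos hKn]
    calc _ ≤ (K : ℝ) / n * (s * n) := mul_le_mul_of_nonneg_left hs hKn.le
      _ = K * s := by field_simp
  · rw [Finset.sum_mul]
    refine (Finset.abs_sum_le_sum_abs _ _).trans (Finset.sum_le_sum fun a _ => ?_)
    rw [abs_mul, abs_of_nonneg (hw0 a), abs_mul, abs_of_pos hKn]
    refine mul_le_mul_of_nonneg_left ?_ (hw0 a)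
    rw [div_mul_eq_mul_div, div_le_iff₀ hn]
    exact (mul_le_mul_of_nonneg_left (E.abs_numHits_sub_genuineHits_le t ω a h) hK'.le).trans (hd a)

end Execution

/-! ### The regret of one round -/

namespace Execution

variable {X : Type*} [MeasurableSpace X] {K m : ℕ} {I : PPCInstance X K m} {ε : ℝ} {T : ℕ}
  {Ω : Type*} [mΩ : MeasurableSpace Ω] {P : Measure Ω}

/-- The expert that is followed if round `t` is an exploit round. -/
noncomputable def chosen (E : Execution I ε T P) (G : GreedyRule K m) (t : ℕ) (ω : Ω) : Fin m :=
  G.choose (E.estimate t ω) (E.bid t ω)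

/-- The genuine welfare `c^t(a^t) μ(a^t)` of round `t`. -/
noncomputable def roundWelfare (E : Execution I ε T P) (G : GreedyRule K m) (t : ℕ) (ω : Ω) : ℝ :=
  (if E.click t ω (E.arm G t ω) = true then 1 else 0) * I.value (E.arm G t ω)

theorem measurableSet_explore_hit (E : Execution I ε T P) {τ : ℕ} (hτ : τ < T) (a : Fin K)
    (h : Fin m) : MeasurableSet[E.hist (τ + 1)] {ω | E.explore τ ω = true ∧
      I.expert h (E.ctx τ ω) = a ∧ E.draw τ ω = a ∧ E.seen τ ω a = true} := by
  have := MeasurableSet.inter (E.measurableSet_explore_draw hτ true a)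
    (E.preLottery_le_hist hτ _ (E.measurableSet_reportedHit τ h a))
  convert this using 1
  ext ω
  simp only [Set.mem_ofPred_eq, Set.mem_inter_iff]
  tauto

theorem measurable_numHits (E : Execution I ε T P) {t : ℕ} (ht : t < T) (a : Fin K) (h : Fin m) :
    Measurable[E.hist t] fun ω => E.numHits t ω a h :=
  measurable_card_filter (p := fun τ ω => E.explore τ ω = true ∧ I.expert h (E.ctx τ ω) = a ∧
    E.draw τ ω = a ∧ E.seen τ ω a = true) fun _ hτ =>
      E.hist.mono (Nat.succ_le_of_lt hτ) _ (E.measurableSet_explore_hit (hτ.trans ht) a h)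

theorem measurable_numExplore (E : Execution I ε T P) {t : ℕ} (ht : t < T) :
    Measurable[E.hist t] (E.numExplore t) :=
  measurable_card_filter (p := fun τ ω => E.explore τ ω = true) fun _ hτ =>
    E.hist.mono (Nat.succ_le_of_lt hτ) _ (E.measurableSet_explore (hτ.trans ht) true)

/-- The estimates take countably many values, so that measurability of the tie-breaking in the bids
is enough. -/
theorem measurable_choose_ratio (G : GreedyRule K m) :
    Measurable fun p : ((Fin K → Fin m → ℕ) × ℕ) × (Fin K → ℝ) =>
      G.choose (fun a h => (p.1.1 a h : ℝ) * K / p.1.2) p.2 :=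
  measurable_from_prod_countable_right fun c =>
    G.measurable_choose fun a h => (c.1 a h : ℝ) * K / c.2

theorem measurable_chosen (E : Execution I ε T P) (G : GreedyRule K m) {t : ℕ} (ht : t < T) :
    Measurable[E.hist t] (E.chosen G t) := by
  have h1 : Measurable[E.hist t] fun ω => E.numHits t ω :=
    measurable_pi_pi fun a h => E.measurable_numHits ht a h
  have h2 : Measurable[E.hist t] fun ω => ((E.numHits t ω, E.numExplore t ω), E.bid t ω) :=
    Measurable.prodMk (Measurable.prodMk h1 (E.measurable_numExplore ht)) (E.bid_measurable t ht)
  have e : E.chosen G t = (fun p : ((Fin K → Fin m → ℕ) × ℕ) × (Fin K → ℝ) =>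
      G.choose (fun a h => (p.1.1 a h : ℝ) * K / p.1.2) p.2) ∘
        fun ω => ((E.numHits t ω, E.numExplore t ω), E.bid t ω) := rfl
  rw [e]
  exact (measurable_choose_ratio G).comp h2

theorem measurable_arm (E : Execution I ε T P) (G : GreedyRule K m) {t : ℕ} (ht : t < T) :
    Measurable[E.hist (t + 1)] (E.arm G t) := by
  have hE : Measurable fun p : Fin m × X => I.expert p.1 p.2 :=
    measurable_from_prod_countable_right fun h => I.expert_measurable h
  exact Measurable.ite (E.measurableSet_explore ht true) (E.draw_measurable t ht)
    (hE.comp (Measurable.prodMk ((E.measurable_chosen G ht).mono (E.hist.mono (Nat.le_succ t)) le_rfl)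
      (E.ctx_measurable t ht)))

theorem measurable_roundWelfare (E : Execution I ε T P) (G : GreedyRule K m) {t : ℕ}
    (ht : t < T) : Measurable (E.roundWelfare G t) := by
  let F : (Fin K → Bool) × Fin K → ℝ := fun p =>
    (if p.1 p.2 = true then 1 else 0) * I.value p.2
  have hF : Measurable F := measurable_from_prod_countable_right fun c => Measurable.of_discrete
  exact hF.comp (Measurable.prodMk ((E.click_measurable t ht).mono (E.hist.le _) le_rfl)
    ((E.measurable_arm G ht).mono (E.hist.le _) le_rfl))

theorem roundWelfare_mem_Icc (E : Execution I ε T P) (G : GreedyRule K m) (t : ℕ) (ω : Ω) :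
    E.roundWelfare G t ω ∈ Set.Icc 0 1 := by
  have := I.value_mem (E.arm G t ω)
  unfold roundWelfare
  split_ifs
  · rw [one_mul]; exact this
  · simp

theorem integrable_roundWelfare [IsProbabilityMeasure P] (E : Execution I ε T P)
    (G : GreedyRule K m) {t : ℕ} (ht : t < T) : Integrable (E.roundWelfare G t) P :=
  integrable_of_abs_le (E.measurable_roundWelfare G ht) 1 fun ω => by
    have := E.roundWelfare_mem_Icc G t ω
    rw [abs_of_nonneg this.1]; exact this.2

theorem expectedRegret_eq_sum [IsProbabilityMeasure P] (E : Execution I ε T P)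
    (G : GreedyRule K m) :
    E.expectedRegret G
      = ∑ t ∈ Finset.range T, (I.bestWelfare - ∫ ω, E.roundWelfare G t ω ∂P) := by
  have h : E.expectedRegret G
      = ∫ ω, (T * I.bestWelfare - ∑ t ∈ Finset.range T, E.roundWelfare G t ω) ∂P := rfl
  rw [h, integral_sub (integrable_const _) (integrable_finsetSum _ fun t ht =>
    E.integrable_roundWelfare G (Finset.mem_range.1 ht)), integral_finsetSum _ fun t ht =>
    E.integrable_roundWelfare G (Finset.mem_range.1 ht), Finset.sum_sub_distrib]
  simp

theorem expectedRegret_le_horizon [IsProbabilityMeasure P] (E : Execution I ε T P)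
    (G : GreedyRule K m) : E.expectedRegret G ≤ T := by
  rw [expectedRegret_eq_sum]
  calc _ ≤ ∑ t ∈ Finset.range T, (1 : ℝ) := Finset.sum_le_sum fun t _ => by
        have h1 := I.bestWelfare_le_one
        have h2 : 0 ≤ ∫ ω, E.roundWelfare G t ω ∂P :=
          integral_nonneg fun ω => (E.roundWelfare_mem_Icc G t ω).1
        linarith
    _ = T := by simp

theorem integrable_welfare_chosen [IsProbabilityMeasure P] (E : Execution I ε T P)
    (G : GreedyRule K m) {t : ℕ} (ht : t < T) :
    Integrable (fun ω => I.welfare (E.chosen G t ω)) P :=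
  integrable_of_abs_le ((Measurable.of_discrete (f := I.welfare)).comp
    ((E.measurable_chosen G ht).mono (E.hist.le t) le_rfl)) 1 fun ω => by
      rw [abs_of_nonneg (I.welfare_nonneg _)]; exact I.welfare_le_one _

/-- An exploit round yields the welfare of the chosen expert in expectation; explore rounds are
credited with nothing. -/
theorem le_integral_roundWelfare [IsProbabilityMeasure P] (E : Execution I ε T P)
    (G : GreedyRule K m) (hK : 0 < K) (hε1 : ε ≤ 1) {t : ℕ} (ht : t < T) :
    (∫ ω, I.welfare (E.chosen G t ω) ∂P) * (1 - ε) ≤ ∫ ω, E.roundWelfare G t ω ∂P := by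
  let V : Fin m → Ω → ℝ := fun h ω => if E.chosen G t ω = h then 1 else 0
  have hVm : ∀ h, Measurable[E.hist t] (V h) := fun h =>
    measurable_ite_one (E.measurable_chosen G ht (measurableSet_singleton h))
  have hVi : ∀ h, Integrable (V h) P := fun h =>
    integrable_of_abs_le ((hVm h).mono (E.hist.le t) le_rfl) 1 fun ω => by
      simp only [V]; split_ifs <;> simp
  let D : Fin m → Fin K → Ω → ℝ := fun h a ω =>
    V h ω * (if I.expert h (E.ctx t ω) = a ∧ E.click t ω a = true then 1 else 0)
  have hDm : ∀ h a, Measurable[E.preLottery t] (D h a) := fun h a =>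
    ((hVm h).mono (E.hist_le_preLottery t) le_rfl).mul
      (measurable_ite_one (E.measurableSet_genuineHit t h a))
  have hDi : ∀ h a, Integrable (D h a) P := fun h a =>
    integrable_mul_ite (E.preLottery_le ht _ (E.measurableSet_genuineHit t h a)) (hVi h)
  let S : Ω → ℝ := fun ω => ∑ h, ∑ a, I.value a * D h a ω
  have hSm : Measurable[E.preLottery t] S := Finset.measurable_sum _ fun h _ =>
    Finset.measurable_sum _ fun a _ => measurable_const.mul (hDm h a)
  have hSi : Integrable S P := integrable_finsetSum _ fun h _ =>
    integrable_finsetSum _ fun a _ => (hDi h a).const_mul _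
  have hS : ∫ ω, S ω ∂P = ∫ ω, I.welfare (E.chosen G t ω) ∂P := by
    have e : ∀ ω, I.welfare (E.chosen G t ω) = ∑ h, V h ω * I.welfare h := by
      intro ω; simp [V]
    simp only [e, S]
    rw [integral_finsetSum _ fun h _ => integrable_finsetSum _ fun a _ => (hDi h a).const_mul _,
      integral_finsetSum _ fun h _ => (hVi h).mul_const _]
    refine Finset.sum_congr rfl fun h _ => ?_
    rw [integral_finsetSum _ fun a _ => (hDi h a).const_mul _, integral_mul_const,
      I.welfare_eq_sum, Finset.mul_sum]
    refine Finset.sum_congr rfl fun a _ => ?_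
    rw [integral_const_mul, E.integral_mul_genuineHit ht a h (hVm h)]
    ring
  have hS_eq : ∀ ω, S ω = (if E.click t ω (I.expert (E.chosen G t ω) (E.ctx t ω)) = true then 1
      else 0) * I.value (I.expert (E.chosen G t ω) (E.ctx t ω)) := by
    intro ω
    simp only [S, D, V]
    rw [Finset.sum_eq_single (E.chosen G t ω) (fun h _ hh => by simp [hh.symm]) (by simp),
      Finset.sum_eq_single (I.expert (E.chosen G t ω) (E.ctx t ω))
        (fun a _ ha => by simp [ha.symm]) (by simp)]
    simp
  rw [← hS, ← E.integral_mul_exploit hK hε1 ht hSm hSi]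
  refine integral_mono (integrable_mul_ite (E.hist.le _ _ (E.measurableSet_explore ht false)) hSi)
    (E.integrable_roundWelfare G ht) fun ω => ?_
  by_cases h : E.explore t ω = true
  · simpa [h] using (E.roundWelfare_mem_Icc G t ω).1
  · have h' : E.explore t ω = false := by simpa using h
    simp only [h', if_true, mul_one, hS_eq, roundWelfare, arm, chosen, Bool.false_eq_true, if_false]
    exact le_rfl

theorem expectedRegret_le_add_sum [IsProbabilityMeasure P] (E : Execution I ε T P)
    (G : GreedyRule K m) (hK : 0 < K) (hε : 0 ≤ ε) (hε1 : ε ≤ 1) :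
    E.expectedRegret G ≤ T * ε
      + ∑ t ∈ Finset.range T, ∫ ω, (I.bestWelfare - I.welfare (E.chosen G t ω)) ∂P := by
  have : (T : ℝ) * ε = ∑ t ∈ Finset.range T, ε := by simp
  rw [expectedRegret_eq_sum, this, ← Finset.sum_add_distrib]
  refine Finset.sum_le_sum fun t ht => ?_
  have ht := Finset.mem_range.1 ht
  have h1 := E.le_integral_roundWelfare G hK hε1 ht
  rw [integral_sub (integrable_const _) (E.integrable_welfare_chosen G ht)]
  have h2 : ∫ ω, I.welfare (E.chosen G t ω) ∂P ≤ 1 := by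
    calc _ ≤ ∫ _, (1 : ℝ) ∂P := integral_mono (E.integrable_welfare_chosen G ht)
          (integrable_const _) fun ω => I.welfare_le_one _
      _ = 1 := by simp
  have : ∫ _, I.bestWelfare ∂P = I.bestWelfare := by simp
  nlinarith

theorem integral_best_sub_le_one [IsProbabilityMeasure P] (E : Execution I ε T P)
    (G : GreedyRule K m) {t : ℕ} (ht : t < T) :
    ∫ ω, (I.bestWelfare - I.welfare (E.chosen G t ω)) ∂P ≤ 1 := by
  calc _ ≤ ∫ _, (1 : ℝ) ∂P := integral_mono
        ((integrable_const _).sub (E.integrable_welfare_chosen G ht)) (integrable_const _)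
        fun ω => by
          have := I.bestWelfare_le_one; have := I.welfare_nonneg (E.chosen G t ω)
          change I.bestWelfare - _ ≤ 1
          linarith
    _ = 1 := by simp

/-- The weights on the arms for which the estimates must be accurate: the agents' values, for the
welfare, and the unit vectors, for the incentives. -/
noncomputable def testWeight (I : PPCInstance X K m) : Option (Fin K) → Fin K → ℝ
  | none => I.value
  | some a => Pi.single a 1

theorem testWeight_mem_Icc (I : PPCInstance X K m) (o : Option (Fin K)) (a : Fin K) :
    testWeight I o a ∈ Set.Icc (0 : ℝ) 1 := by
  cases o with
  | none => exact I.value_mem a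
  | some b =>
    by_cases h : a = b
    · subst h; simp [testWeight]
    · simp [testWeight, h]

/-- The centred explored rewards of expert `h` for the test weights `o`, before round `t`. -/
noncomputable def deviation (E : Execution I ε T P) (o : Option (Fin K)) (h : Fin m) (t : ℕ)
    (ω : Ω) : ℝ :=
  ∑ a, testWeight I o a * (E.genuineHits t ω a h : ℝ)
    - E.numExplore t ω * ((∑ a, testWeight I o a * I.clickProb a h) / K)

/-- The exceptional event of round `t`, for sampling accuracy `s`: too few explore rounds, an
inaccurate genuine sample, or too many corrupted explore rounds on one arm. The inaccuracy is
expressed through the exponential supermartingales with exponents `4 s` and `-4 s`, at level `x`. -/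
noncomputable def badEvent (E : Execution I ε T P) (C s x : ℝ) (t : ℕ) : Set Ω :=
  {ω | (E.numExplore t ω : ℝ) ≤ ε * t / 2} ∪
    ((⋃ p : (Option (Fin K) × Fin m) × Bool, {ω | x ≤ (if p.2 then 4 * s else -(4 * s)) *
      E.deviation p.1.1 p.1.2 t ω
        - E.numExplore t ω * ((if p.2 then 4 * s else -(4 * s)) ^ 2 / 8)}) ∪
    ⋃ a : Fin K, {ω | ε / K * corruptionTerm K T ε C ≤ E.corruptedDraws t ω a})

theorem measureReal_badEvent_le [IsProbabilityMeasure P] (E : Execution I ε T P) (hK : 0 < K)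
    (hε : 0 < ε) {C : ℝ} (hC : 0 ≤ C) (hE : E.CorruptedAtMost C) (s x : ℝ) {t : ℕ} (ht : t ≤ T) :
    P.real (E.badEvent C s x t) ≤ Real.exp (-(ε * t / 2 * (1 - Real.log 2)))
      + (2 * m * (K + 1) * Real.exp (-x) + K * Real.exp (-(2 * Real.log T))) := by
  refine (measureReal_union_le _ _).trans (add_le_add (E.measureReal_numExplore_le hK hε.le ht)
    ((measureReal_union_le _ _).trans (add_le_add ?_ ?_)))
  · refine (measureReal_iUnion_fintype_le _).trans ?_
    calc _ ≤ ∑ p : (Option (Fin K) × Fin m) × Bool, Real.exp (-x) :=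
          Finset.sum_le_sum fun p _ => E.measureReal_le_sum_exploredReward hK hε.le
            (fun a => (testWeight_mem_Icc I p.1.1 a).1) (fun a => (testWeight_mem_Icc I p.1.1 a).2)
            p.1.2 _ x ht
      _ = _ := by simp; ring
  · refine (measureReal_iUnion_fintype_le _).trans ?_
    calc _ ≤ ∑ a : Fin K, Real.exp (-(2 * Real.log T)) :=
          Finset.sum_le_sum fun a _ => E.measureReal_le_corruptedDraws hK hε hC hE a ht
      _ = _ := by simp

/-- Outside the exceptional event the agents are truthful, provided the accuracy of the estimates
is at least `α / 2`, and then the chosen expert is nearly optimal. -/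
theorem best_sub_welfare_le_of_notMem_badEvent (E : Execution I ε T P) (G : GreedyRule K m)
    (hK : 0 < K) (hε : 0 < ε) {C α s x : ℝ} (hC : 0 ≤ C) (hs : 0 ≤ s) {t : ℕ} (ht0 : 0 < t)
    (hx : x ≤ ε * t * s ^ 2)
    (hα : K * s + 2 * corruptionTerm K T ε C / t ≤ α / 2) {ω : Ω}
    (hω : ω ∉ E.badEvent C s x t)
    (htruth : ∀ a, (∀ y ∈ Set.Icc (0 : ℝ) 1, G.utility I (E.estimate t ω) (E.bid t ω) a y
      - G.utility I (E.estimate t ω) (E.bid t ω) a (I.value a) ≤ α) →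
      E.bid t ω a = I.value a) :
    I.bestWelfare - I.welfare (E.chosen G t ω)
      ≤ 2 * (K * s + K * (2 * corruptionTerm K T ε C / t)) := by
  have hK' : (0 : ℝ) < K := by exact_mod_cast hK
  have ht' : (0 : ℝ) < t := by exact_mod_cast ht0
  simp only [badEvent, Set.mem_union, Set.mem_iUnion, not_or, not_exists] at hω
  obtain ⟨hn, hdev, hcor⟩ := hω
  have hn : ε * t / 2 < E.numExplore t ω := not_le.1 hn
  have hcor : ∀ a, (E.corruptedDraws t ω a : ℝ) < ε / K * corruptionTerm K T ε C :=
    fun a => not_le.1 (hcor a)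
  have hdev : ∀ o h (b : Bool), (if b then 4 * s else -(4 * s)) * E.deviation o h t ω
        - E.numExplore t ω * ((if b then 4 * s else -(4 * s)) ^ 2 / 8) < x :=
    fun o h b => not_le.1 (hdev ((o, h), b))
  have hn0 : 0 < (E.numExplore t ω : ℝ) := lt_of_le_of_lt (by positivity) hn
  -- the exponent `4 s` optimises the tail: on a deviation above `s n` it yields at least
  -- `4 s² n - 2 s² n = 2 s² n ≥ ε t s²`
  have hdev' : ∀ o h, |E.deviation o h t ω| ≤ s * E.numExplore t ω := by
    intro o h
    have h1 := hdev o h true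
    have h2 := hdev o h false
    simp only [if_true, Bool.false_eq_true, if_false] at h1 h2
    have h3 : ε * t * s ^ 2 ≤ 2 * E.numExplore t ω * s ^ 2 := by nlinarith [sq_nonneg s]
    rcases hs.eq_or_lt with rfl | hs
    · exact absurd (h1.trans_le hx) (by simp)
    rw [abs_le]
    constructor <;> nlinarith
  set d : ℝ := 2 * corruptionTerm K T ε C / t with hd
  have hD : 0 ≤ corruptionTerm K T ε C := by
    unfold corruptionTerm; have := le_max_left C (6 * K * Real.log T / ε); linarith
  have hd0 : 0 ≤ d := by positivity
  have hcd : ∀ a, (K : ℝ) * E.corruptedDraws t ω a ≤ d * E.numExplore t ω := by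
    intro a
    have h1 : (K : ℝ) * E.corruptedDraws t ω a ≤ ε * corruptionTerm K T ε C := by
      calc _ ≤ (K : ℝ) * (ε / K * corruptionTerm K T ε C) :=
            mul_le_mul_of_nonneg_left (hcor a).le hK'.le
        _ = _ := by field_simp
    have h2 : ε * corruptionTerm K T ε C = d * (ε * t / 2) := by rw [hd]; field_simp
    rw [h2] at h1
    exact h1.trans (mul_le_mul_of_nonneg_left hn.le hd0)
  have hest := fun o h => E.abs_sum_estimate_sub_le
    (fun a => (testWeight_mem_Icc I o a).1) hn0 (hdev' o h) hcd
  have hbid : E.bid t ω = I.value := by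
    funext a
    refine htruth a fun y hy => ?_
    have hδ : ∀ h, |E.estimate t ω a h - I.clickProb a h| ≤ K * s + d := by
      intro h
      have := hest (some a) h
      simpa [testWeight, Pi.single_apply] using this
    have := G.utility_sub_utility_le I (E.bid t ω) a (E.estimate_nonneg t ω a) hδ hy
    linarith
  rw [chosen, hbid]
  refine G.bestWelfare_sub_welfare_le I fun h => ?_
  refine (hest none h).trans ?_
  have hsum : ∑ a, testWeight I none a ≤ K := by
    calc _ ≤ ∑ _a : Fin K, (1 : ℝ) := Finset.sum_le_sum fun a _ => (testWeight_mem_Icc I none a).2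
      _ = K := by simp
  have := mul_le_mul_of_nonneg_right hsum hd0
  linarith

theorem integral_best_sub_le_add_badEvent [IsProbabilityMeasure P] (E : Execution I ε T P)
    (G : GreedyRule K m)
    (hK : 0 < K) (hε : 0 < ε) {C α s x : ℝ} (hC : 0 ≤ C) (hs : 0 ≤ s) {t : ℕ} (ht0 : 0 < t)
    (ht : t < T) (hx : x ≤ ε * t * s ^ 2)
    (hα : K * s + 2 * corruptionTerm K T ε C / t ≤ α / 2) (hrat : E.AlphaRational G α) :
    ∫ ω, (I.bestWelfare - I.welfare (E.chosen G t ω)) ∂P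
      ≤ 2 * (K * s + K * (2 * corruptionTerm K T ε C / t)) + P.real (E.badEvent C s x t) := by
  set γ : ℝ := 2 * (K * s + K * (2 * corruptionTerm K T ε C / t)) with hγ
  have hD : 0 ≤ corruptionTerm K T ε C := by
    unfold corruptionTerm; have := le_max_left C (6 * K * Real.log T / ε); linarith
  have hγ0 : 0 ≤ γ := by positivity
  have htruth := ae_all_iff.2 (hrat t ht)
  -- a measurable hull, so that measurability of the exceptional event is not needed
  set B := toMeasurable P (E.badEvent C s x t) with hB
  have hBm : MeasurableSet B := measurableSet_toMeasurable _ _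
  have hle : ∀ᵐ ω ∂P, I.bestWelfare - I.welfare (E.chosen G t ω) ≤ γ + B.indicator 1 ω := by
    filter_upwards [htruth] with ω hω
    by_cases h : ω ∈ B
    · have h1 := I.bestWelfare_le_one
      have h2 := I.welfare_nonneg (E.chosen G t ω)
      simp only [h, Set.indicator_of_mem, Pi.one_apply]
      linarith
    · have h1 : ω ∉ E.badEvent C s x t := fun h' => h (subset_toMeasurable _ _ h')
      simp only [h, not_false_eq_true, Set.indicator_of_notMem, add_zero]
      exact E.best_sub_welfare_le_of_notMem_badEvent G hK hε hC hs ht0 hx hα h1 hω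
  have hBi : Integrable (B.indicator (1 : Ω → ℝ)) P := (integrable_const (1 : ℝ)).indicator hBm
  calc _ ≤ ∫ ω, (γ + B.indicator 1 ω) ∂P := integral_mono_ae
        ((integrable_const _).sub (E.integrable_welfare_chosen G ht))
        ((integrable_const _).add hBi) hle
    _ = γ + P.real (E.badEvent C s x t) := by
        rw [integral_add (integrable_const _) hBi, integral_indicator_one hBm]
        simp [hB, measureReal_def, measure_toMeasurable]

end Execution

/-! ### Summation over the rounds -/

theorem sum_one_div_sqrt_le (n : ℕ) :
    ∑ t ∈ Finset.range (n + 1), 1 / √(t : ℝ) ≤ 2 * √(n : ℝ) := by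
  induction n with
  | zero => simp
  | succ n ih =>
    rw [Finset.sum_range_succ]
    have hpos : 0 < √((n + 1 : ℕ) : ℝ) := Real.sqrt_pos.2 (by positivity)
    have h1 : √((n + 1 : ℕ) : ℝ) ^ 2 = n + 1 := by
      rw [Real.sq_sqrt (by positivity)]; push_cast; ring
    have h2 : √(n : ℝ) ^ 2 = n := Real.sq_sqrt (by positivity)
    have h3 : 1 / √((n + 1 : ℕ) : ℝ) ≤ 2 * √((n + 1 : ℕ) : ℝ) - 2 * √(n : ℝ) := by
      rw [div_le_iff₀ hpos]
      nlinarith [sq_nonneg (√((n + 1 : ℕ) : ℝ) - √(n : ℝ))]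
    linarith

/-- Without the term `t = 1` the harmonic sum is bounded by the logarithm, with no additive
constant. -/
theorem sum_ite_two_le_one_div_le_log (n : ℕ) :
    ∑ t ∈ Finset.range (n + 1), (if 2 ≤ t then 1 / (t : ℝ) else 0) ≤ Real.log n := by
  induction n with
  | zero => simp
  | succ n ih =>
    rw [Finset.sum_range_succ]
    rcases Nat.eq_zero_or_pos n with rfl | hn
    · simp
    have hn' : (0 : ℝ) < n := by exact_mod_cast hn
    have h1 := Real.one_sub_inv_le_log_of_pos (show 0 < ((n + 1 : ℕ) : ℝ) / n by positivity)
    rw [Real.log_div (by positivity) hn'.ne'] at h1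
    have h2 : 1 - (((n + 1 : ℕ) : ℝ) / n)⁻¹ = 1 / ((n + 1 : ℕ) : ℝ) := by
      push_cast; field_simp; ring
    rw [if_pos (by omega)]
    linarith

theorem sum_ite_lt_le (n : ℕ) {x : ℝ} (hx : 0 ≤ x) :
    ∑ t ∈ Finset.range n, (if (t : ℝ) < x then (1 : ℝ) else 0) ≤ x + 1 := by
  rw [Finset.sum_boole]
  have h1 : ((Finset.range n).filter fun t : ℕ => (t : ℝ) < x) ⊆ Finset.range ⌈x⌉₊ := by
    intro t ht
    exact Finset.mem_range.2 (Nat.lt_ceil.2 (Finset.mem_filter.1 ht).2)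
  have h2 := Finset.card_le_card h1
  rw [Finset.card_range] at h2
  have h3 : (((Finset.range n).filter fun t : ℕ => (t : ℝ) < x).card : ℝ) ≤ ⌈x⌉₊ := by
    exact_mod_cast h2
  exact h3.trans (Nat.ceil_lt_add_one hx).le

namespace Execution

variable {X : Type*} [MeasurableSpace X] {K m : ℕ} {I : PPCInstance X K m} {ε : ℝ} {T : ℕ}
  {Ω : Type*} [mΩ : MeasurableSpace Ω] {P : Measure Ω}

theorem arms_pos [IsProbabilityMeasure P] (E : Execution I ε T P) : 0 < K := by
  obtain ⟨ω⟩ := nonempty_of_isProbabilityMeasure P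
  exact (E.draw 0 ω).pos

theorem _root_.GreedyRule.experts_pos (G : GreedyRule K m) : 0 < m :=
  (G.choose 0 0).pos

theorem _root_.corruptionTerm_nonneg {C : ℝ} (hC : 0 ≤ C) : 0 ≤ corruptionTerm K T ε C :=
  add_nonneg hC (hC.trans (le_max_left _ _))

theorem one_le_product {K m T : ℕ} (hK : 0 < K) (hm : 0 < m) (hT : 0 < T) :
    (1 : ℝ) ≤ T * m * K := by
  exact_mod_cast Nat.succ_le_of_lt (Nat.mul_pos (Nat.mul_pos hT hm) hK)

theorem measureReal_badEvent_le_div [IsProbabilityMeasure P] (E : Execution I ε T P) (hK : 2 ≤ K)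
    (hm : 0 < m) (hT : 2 ≤ T) (hε : 0 < ε) {C : ℝ} (hC : 0 ≤ C) (hE : E.CorruptedAtMost C) (s : ℝ)
    {t : ℕ} (ht : t ≤ T) (htL : 8 * (K : ℝ) ^ 2 * Real.log (T * m * K) ≤ ε * t) :
    P.real (E.badEvent C s (Real.log (T * m * K)) t) ≤ (4 + K / 2) / T := by
  have hK' : (2 : ℝ) ≤ K := by exact_mod_cast hK
  have hT' : (2 : ℝ) ≤ T := by exact_mod_cast hT
  have hm' : (1 : ℝ) ≤ m := by exact_mod_cast hm
  have h1 : (1 : ℝ) ≤ T * m * K := one_le_product (by omega) hm (by omega)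
  have hL : 0 ≤ Real.log (T * m * K) := Real.log_nonneg h1
  refine (E.measureReal_badEvent_le (by omega) hε hC hE s _ ht).trans ?_
  have hexp : Real.exp (-Real.log (T * m * K)) = 1 / (T * m * K) := by
    rw [Real.exp_neg, Real.exp_log (by linarith), one_div]
  have e1 : Real.exp (-(ε * t / 2 * (1 - Real.log 2))) ≤ 1 / T := by
    have h2 := Real.log_two_lt_d9
    have h3 : 4 ≤ (K : ℝ) ^ 2 := by nlinarith
    have h4 : Real.log (T * m * K) ≤ ε * t / 2 * (1 - Real.log 2) := by
      have a := mul_le_mul_of_nonneg_right h3 hL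
      have b : ε * t * (3 / 10) ≤ ε * t * (1 - Real.log 2) :=
        mul_le_mul_of_nonneg_left (by linarith) (by positivity)
      linarith
    calc _ ≤ Real.exp (-Real.log (T * m * K)) := Real.exp_le_exp.2 (neg_le_neg h4)
      _ = 1 / (T * m * K) := hexp
      _ ≤ 1 / T := by
        refine one_div_le_one_div_of_le (by linarith) ?_
        rw [mul_assoc]
        exact le_mul_of_one_le_right (by linarith) (by nlinarith)
  have e2 : 2 * m * (K + 1) * Real.exp (-Real.log (T * m * K)) ≤ 3 / T := by
    rw [hexp, mul_one_div, div_le_div_iff₀ (by linarith) (by linarith)]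
    have : 0 ≤ (T : ℝ) * m * (K - 2) :=
      mul_nonneg (mul_nonneg (by linarith) (by linarith)) (by linarith)
    nlinarith
  have e3 : K * Real.exp (-(2 * Real.log T)) ≤ (K / 2) / T := by
    have : Real.exp (-(2 * Real.log T)) = 1 / (T : ℝ) ^ 2 := by
      rw [Real.exp_neg, two_mul, Real.exp_add, Real.exp_log (by linarith), one_div, sq]
    rw [this, mul_one_div, div_le_div_iff₀ (by positivity) (by linarith)]
    have : 0 ≤ (K : ℝ) * T * (T - 2) := by
      refine mul_nonneg (by positivity) (by linarith)
    nlinarith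
  have e4 : (4 + (K : ℝ) / 2) / T = 1 / T + (3 / T + (K / 2) / T) := by ring
  rw [e4]
  linarith

/-- The regret of one round against the best expert: at most `1` in the early rounds, and at most
the estimation error plus the probability of the exceptional event later on. -/
theorem integral_best_sub_le [IsProbabilityMeasure P] (E : Execution I ε T P) (G : GreedyRule K m)
    (hK : 2 ≤ K) (hT : 2 ≤ T) (hε : 0 < ε) (hε1 : ε ≤ 1) {C α : ℝ} (hα : 0 < α) (hα1 : α ≤ 1)
    (hC : 0 ≤ C) (hE : E.CorruptedAtMost C) (hrat : E.AlphaRational G α) {t : ℕ} (ht : t < T) :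
    ∫ ω, (I.bestWelfare - I.welfare (E.chosen G t ω)) ∂P ≤
      (if (t : ℝ) < 8 * (K : ℝ) ^ 2 * Real.log (T * m * K) / (ε * α ^ 2)
        + 16 * corruptionTerm K T ε C / α then 1 else 0)
      + (2 * K * √(Real.log (T * m * K) / ε)) * (1 / √(t : ℝ))
      + (4 * K * corruptionTerm K T ε C) * (if 2 ≤ t then 1 / (t : ℝ) else 0)
      + (4 + K / 2) / T := by
  have hm := G.experts_pos
  have hK' : (2 : ℝ) ≤ K := by exact_mod_cast hK
  have hT' : (2 : ℝ) ≤ T := by exact_mod_cast hT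
  have hm' : (1 : ℝ) ≤ m := by exact_mod_cast hm
  have hD : 0 ≤ corruptionTerm K T ε C := corruptionTerm_nonneg hC
  set D := corruptionTerm K T ε C
  have hlog4 : Real.log 4 ≤ Real.log (T * m * K) := by
    refine Real.log_le_log (by norm_num) ?_
    nlinarith [mul_le_mul hT' hm' zero_le_one (by linarith : (0 : ℝ) ≤ T)]
  have hlog4' : (1 : ℝ) ≤ Real.log 4 := by
    have : Real.log 4 = 2 * Real.log 2 := by
      rw [show (4 : ℝ) = 2 ^ 2 by norm_num, Real.log_pow]; norm_num
    rw [this]; linarith [Real.log_two_gt_d9]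
  set L := Real.log (T * m * K) with hLdef
  have hL : 1 ≤ L := hlog4'.trans hlog4
  have hnn : 0 ≤ (4 * K * D) * (if 2 ≤ t then 1 / (t : ℝ) else 0) := by
    refine mul_nonneg (by positivity) ?_
    split_ifs
    · positivity
    · exact le_rfl
  have hnn2 : 0 ≤ (2 * K * √(L / ε)) * (1 / √(t : ℝ)) := by positivity
  by_cases hlt : (t : ℝ) < 8 * (K : ℝ) ^ 2 * L / (ε * α ^ 2) + 16 * D / α
  · rw [if_pos hlt]
    have := E.integral_best_sub_le_one G ht
    have : 0 ≤ (4 + (K : ℝ) / 2) / T := by positivity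
    linarith
  rw [if_neg hlt]
  have hge := not_lt.1 hlt
  have h1 : 8 * (K : ℝ) ^ 2 * L / (ε * α ^ 2) ≤ t :=
    (le_add_of_nonneg_right (by positivity)).trans hge
  have h2 : 16 * D / α ≤ t := (le_add_of_nonneg_left (by positivity)).trans hge
  rw [div_le_iff₀ (by positivity)] at h1
  rw [div_le_iff₀ hα] at h2
  have ht0 : (0 : ℝ) ≤ t := by positivity
  have hα2 : α ^ 2 ≤ 1 := pow_le_one₀ hα.le hα1
  have h3 : 8 * (K : ℝ) ^ 2 * L ≤ ε * t := by
    have := mul_le_mul_of_nonneg_left hα2 (mul_nonneg ht0 hε.le)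
    linarith
  have hK2 : 4 ≤ (K : ℝ) ^ 2 := by nlinarith
  -- in particular `t ≥ 2`, so that the term `1 / 1` of the harmonic sum is never needed
  have h4 : (32 : ℝ) ≤ t := by
    have a : 4 * 1 ≤ (K : ℝ) ^ 2 * L := mul_le_mul hK2 hL zero_le_one (by positivity)
    have b := mul_le_mul_of_nonneg_right hε1 ht0
    linarith
  have ht2 : 2 ≤ t := by
    have : (2 : ℝ) ≤ t := by linarith
    exact_mod_cast this
  have htpos : (0 : ℝ) < t := by linarith
  -- this accuracy makes the failure probability `exp (-L) = 1 / (T m K)` if `n ≥ ε t / 2`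
  set s : ℝ := √(L / (ε * t)) with hs
  have hs2 : s ^ 2 = L / (ε * t) := Real.sq_sqrt (by positivity)
  have hs0 : 0 ≤ s := Real.sqrt_nonneg _
  have hx : L ≤ ε * t * s ^ 2 := by
    rw [hs2]; refine le_of_eq ?_; field_simp
  -- the accuracy `α / 2` splits into `α / √8 ≤ 3 α / 8` for sampling and `α / 8` for corruption
  have hKs : K * s ≤ 3 * α / 8 := by
    refine le_of_sq_le_sq ?_ (by positivity)
    rw [mul_pow, hs2, ← mul_div_assoc, div_le_iff₀ (by positivity)]
    have : 0 ≤ (t : ℝ) * (ε * α ^ 2) := by positivity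
    linarith
  have hDt : 2 * D / t ≤ α / 8 := by
    rw [div_le_iff₀ htpos]; linarith
  have hb := E.measureReal_badEvent_le_div hK hm hT hε hC hE s ht.le h3
  have hr := E.integral_best_sub_le_add_badEvent G (by omega) hε hC hs0 (by omega) ht hx
    (α := α) (by linarith) hrat
  have e1 : (2 * K * √(L / ε)) * (1 / √(t : ℝ)) = 2 * (K * s) := by
    rw [hs, ← div_div, Real.sqrt_div (by positivity) (t : ℝ)]; ring
  have e2 : (4 * K * D) * (if 2 ≤ t then 1 / (t : ℝ) else 0) = 2 * (K * (2 * D / t)) := by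
    rw [if_pos ht2]; ring
  rw [e1, e2]
  linarith

theorem expectedRegret_le [IsProbabilityMeasure P] (E : Execution I ε T P) (G : GreedyRule K m)
    (hε : 0 < ε) (hε1 : ε ≤ 1) {C α : ℝ} (hα : 0 < α) (hα1 : α ≤ 1)
    (hC : 0 ≤ C) (hE : E.CorruptedAtMost C) (hrat : E.AlphaRational G α) :
    E.expectedRegret G ≤
      T * ε + (K : ℝ) ^ 2 * √(8 * T * Real.log (T * m * K) / ε) + 3 * K
        + 8 * (K : ℝ) ^ 2 * Real.log (T * m * K) / (ε * α ^ 2)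
        + 16 * corruptionTerm K T ε C / α
        + 4 * K * corruptionTerm K T ε C * Real.log T := by
  have hK := E.arms_pos
  have hm := G.experts_pos
  have hD : 0 ≤ corruptionTerm K T ε C := corruptionTerm_nonneg hC
  set D := corruptionTerm K T ε C
  have hK' : (1 : ℝ) ≤ K := by exact_mod_cast hK
  have hL : 0 ≤ Real.log (T * m * K) := by
    have : (T * m * K : ℝ) = ((T * m * K : ℕ) : ℝ) := by push_cast; ring
    rw [this]; exact Real.log_natCast_nonneg _
  have hlogT : 0 ≤ Real.log T := Real.log_natCast_nonneg T
  set L := Real.log (T * m * K) with hLdef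
  have n1 : 0 ≤ (K : ℝ) ^ 2 * √(8 * T * L / ε) := by positivity
  have n2 : 0 ≤ 8 * (K : ℝ) ^ 2 * L / (ε * α ^ 2) := by positivity
  have n3 : 0 ≤ 16 * D / α := by positivity
  have n4 : 0 ≤ 4 * K * D * Real.log T := by positivity
  have n5 : 0 ≤ T * ε := by positivity
  rcases Nat.lt_or_ge T 2 with hT | hT
  · have h1 := E.expectedRegret_le_horizon G
    have h2 : (T : ℝ) ≤ 1 := by exact_mod_cast Nat.le_of_lt_succ hT
    linarith
  have hsum := E.expectedRegret_le_add_sum G hK hε.le hε1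
  rcases Nat.lt_or_ge K 2 with hK1 | hK2
  · -- with one arm all experts have the same welfare
    have hsub : Subsingleton (Fin K) := Fin.subsingleton_iff_le_one.2 (by omega)
    have h0 : ∀ h, I.bestWelfare - I.welfare h = 0 := by
      intro h
      have : Nonempty (Fin m) := ⟨h⟩
      have hw : ∀ h', I.welfare h' = I.welfare h := fun h' => by
        have : I.expert h' = I.expert h := funext fun x => Subsingleton.elim _ _
        simp only [PPCInstance.welfare, this]
      rw [PPCInstance.bestWelfare, sub_eq_zero]
      simp only [hw, ciSup_const]
    simp only [h0, integral_zero, Finset.sum_const_zero, add_zero] at hsum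
    linarith
  refine hsum.trans ?_
  have hT' : (2 : ℝ) ≤ T := by exact_mod_cast hT
  have hK2' : (2 : ℝ) ≤ K := by exact_mod_cast hK2
  have hle := Finset.sum_le_sum fun t (ht : t ∈ Finset.range T) =>
    E.integral_best_sub_le G hK2 hT hε hε1 hα hα1 hC hE hrat (Finset.mem_range.1 ht)
  simp only [Finset.sum_add_distrib, ← Finset.mul_sum] at hle
  have s1 := sum_ite_lt_le T (add_nonneg n2 n3)
  obtain ⟨n, rfl⟩ : ∃ n, T = n + 1 := ⟨T - 1, by omega⟩
  have hnT : (n : ℝ) ≤ ((n + 1 : ℕ) : ℝ) := by push_cast; linarith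
  have s2 : ∑ t ∈ Finset.range (n + 1), 1 / √(t : ℝ) ≤ 2 * √((n + 1 : ℕ) : ℝ) :=
    (sum_one_div_sqrt_le n).trans (by
      have := Real.sqrt_le_sqrt hnT; linarith)
  have s3 : ∑ t ∈ Finset.range (n + 1), (if 2 ≤ t then 1 / (t : ℝ) else 0)
      ≤ Real.log ((n + 1 : ℕ) : ℝ) :=
    (sum_ite_two_le_one_div_le_log n).trans (Real.log_le_log
      (by have : 1 ≤ n := by omega
          exact_mod_cast this) hnT)
  have s4 : ∑ _t ∈ Finset.range (n + 1), (4 + (K : ℝ) / 2) / ((n + 1 : ℕ) : ℝ) = 4 + K / 2 := by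
    rw [Finset.sum_const, Finset.card_range, nsmul_eq_mul, mul_div_cancel₀]
    positivity
  have s2' := mul_le_mul_of_nonneg_left s2 (by positivity : 0 ≤ 2 * K * √(L / ε))
  have s3' := mul_le_mul_of_nonneg_left s3 (by positivity : 0 ≤ 4 * K * D)
  have e1 : 2 * K * √(L / ε) * (2 * √((n + 1 : ℕ) : ℝ))
      ≤ (K : ℝ) ^ 2 * √(8 * (n + 1 : ℕ) * L / ε) := by
    have h1 : √(8 * (n + 1 : ℕ) * L / ε) = √8 * (√((n + 1 : ℕ) : ℝ) * √(L / ε)) := by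
      rw [← Real.sqrt_mul (by positivity), ← Real.sqrt_mul (by positivity)]
      congr 1; ring
    have h2 : (2 : ℝ) ≤ √8 := Real.le_sqrt_of_sq_le (by norm_num)
    have h3 : 4 * (K : ℝ) ≤ (K : ℝ) ^ 2 * √8 := by nlinarith
    have h4 := mul_le_mul_of_nonneg_right h3
      (by positivity : 0 ≤ √((n + 1 : ℕ) : ℝ) * √(L / ε))
    rw [h1]
    linarith
  rw [s4] at hle
  linarith

end Execution

/-! ### The tuned exploration rate -/

/-- The regret bound at the rate `2 l k⁴ / x`, for `x = T ^ (1 / 3)`, `k = K ^ (1 / 3)` and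
`l = log (T m K) ^ (1 / 3)`, with `D` for `C'` and `lT` for `log T`. -/
theorem tuned_bound_le {x k l α C D lT : ℝ} (hx : 1 ≤ x) (hk : 1 ≤ k) (hl : 0 < l) (hα : 0 < α)
    (hα1 : α ≤ 1) (hC : 0 ≤ C) (hlT0 : 0 ≤ lT) (hlT : lT ≤ l ^ 3)
    (hD : D ≤ 2 * C + 6 * k ^ 3 * lT / (2 * l * k ^ 4 / x)) :
    x ^ 3 * (2 * l * k ^ 4 / x)
      + (k ^ 3) ^ 2 * √(8 * x ^ 3 * l ^ 3 / (2 * l * k ^ 4 / x)) + 3 * k ^ 3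
      + 8 * (k ^ 3) ^ 2 * l ^ 3 / (2 * l * k ^ 4 / x * α ^ 2)
      + 16 * D / α + 4 * k ^ 3 * D * lT
    ≤ 100 * (1 + l ^ 3) ^ 2 * (x ^ 2 * k ^ 4 + x * k ^ 2 / α ^ 2 + C / α + k ^ 3 * C) := by
  have hx0 : 0 < x := by linarith
  have hk0 : 0 < k := by linarith
  have l1 : l ≤ 1 + l ^ 3 := by nlinarith [sq_nonneg (l - 1), sq_nonneg (l + 1)]
  have l2 : l ^ 2 ≤ 1 + l ^ 3 := by nlinarith [sq_nonneg (l - 1), sq_nonneg (l + 1)]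
  have l0 : 1 ≤ 1 + l ^ 3 := by have := pow_pos hl 3; linarith
  set M := 1 + l ^ 3 with hM
  have hMM : M ≤ M ^ 2 := by nlinarith
  have hl3 : l ^ 3 ≤ M := by linarith
  have l5 : l ^ 2 * l ^ 3 ≤ M ^ 2 := by
    rw [sq M]; exact mul_le_mul l2 hl3 (by positivity) (by linarith)
  have hD' : D ≤ 2 * C + 3 * l ^ 2 * x / k := by
    refine hD.trans (add_le_add le_rfl ?_)
    calc _ ≤ 6 * k ^ 3 * l ^ 3 / (2 * l * k ^ 4 / x) := by gcongr
      _ = _ := by field_simp; ring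
  have hDk : D ≤ 2 * C + 3 * l ^ 2 * x := by
    refine hD'.trans (add_le_add le_rfl (div_le_self (by positivity) hk))
  have t1 : x ^ 3 * (2 * l * k ^ 4 / x) = 2 * l * (x ^ 2 * k ^ 4) := by field_simp
  have t2 : (k ^ 3) ^ 2 * √(8 * x ^ 3 * l ^ 3 / (2 * l * k ^ 4 / x)) = 2 * l * (x ^ 2 * k ^ 4) := by
    have : 8 * x ^ 3 * l ^ 3 / (2 * l * k ^ 4 / x) = (2 * x ^ 2 * l / k ^ 2) ^ 2 := by
      field_simp; ring
    rw [this, Real.sqrt_sq (by positivity)]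
    field_simp
  have t3 : 3 * k ^ 3 ≤ 3 * (x ^ 2 * k ^ 4) := by
    have h1 : k ^ 3 ≤ k ^ 4 := pow_le_pow_right₀ hk (by norm_num)
    have h2 : k ^ 4 ≤ x ^ 2 * k ^ 4 := le_mul_of_one_le_left (by positivity) (one_le_pow₀ hx)
    linarith
  have t4 : 8 * (k ^ 3) ^ 2 * l ^ 3 / (2 * l * k ^ 4 / x * α ^ 2)
      = 4 * l ^ 2 * (x * k ^ 2 / α ^ 2) := by field_simp; ring
  have hxα : x / α ≤ x * k ^ 2 / α ^ 2 := by
    rw [div_le_div_iff₀ hα (by positivity)]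
    have : 1 ≤ k ^ 2 := one_le_pow₀ hk
    have h1 : x * α * α ≤ x * α * k ^ 2 := mul_le_mul_of_nonneg_left (by linarith) (by positivity)
    linarith
  have hxk : x * k ^ 2 ≤ x * k ^ 2 / α ^ 2 :=
    le_div_self (by positivity) (by positivity) (pow_le_one₀ hα.le hα1)
  have t5 : 16 * D / α ≤ 32 * (C / α) + 48 * l ^ 2 * (x * k ^ 2 / α ^ 2) := by
    calc 16 * D / α ≤ 16 * (2 * C + 3 * l ^ 2 * x) / α := by gcongr
      _ = 32 * (C / α) + 48 * l ^ 2 * (x / α) := by ring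
      _ ≤ _ := by gcongr
  have t6 : 4 * k ^ 3 * D * lT ≤ 8 * l ^ 3 * (k ^ 3 * C) + 12 * (l ^ 2 * l ^ 3) * (x * k ^ 2 / α ^ 2) := by
    calc 4 * k ^ 3 * D * lT ≤ 4 * k ^ 3 * (2 * C + 3 * l ^ 2 * x / k) * lT := by gcongr
      _ ≤ 4 * k ^ 3 * (2 * C + 3 * l ^ 2 * x / k) * l ^ 3 := by gcongr
      _ = 8 * l ^ 3 * (k ^ 3 * C) + 12 * (l ^ 2 * l ^ 3) * (x * k ^ 2) := by field_simp; ring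
      _ ≤ _ := by gcongr
  have p1 : 0 ≤ x ^ 2 * k ^ 4 := by positivity
  have p2 : 0 ≤ x * k ^ 2 / α ^ 2 := by positivity
  have p3 : 0 ≤ C / α := by positivity
  have p4 : 0 ≤ k ^ 3 * C := by positivity
  have q1 := mul_le_mul_of_nonneg_right (l1.trans hMM) p1
  have q2 := mul_le_mul_of_nonneg_right (l0.trans hMM) p1
  have q3 := mul_le_mul_of_nonneg_right (l2.trans hMM) p2
  have q4 := mul_le_mul_of_nonneg_right l5 p2
  have q5 := mul_le_mul_of_nonneg_right (l0.trans hMM) p3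
  have q6 := mul_le_mul_of_nonneg_right (hl3.trans hMM) p4
  have r1 := mul_nonneg (sq_nonneg M) p1
  have r2 := mul_nonneg (sq_nonneg M) p2
  have r3 := mul_nonneg (sq_nonneg M) p3
  have r4 := mul_nonneg (sq_nonneg M) p4
  rw [t1, t2, t4]
  linarith

theorem rpow_third_pow {x : ℝ} (hx : 0 ≤ x) (n : ℕ) : (x ^ (1 / 3 : ℝ)) ^ n = x ^ (n / 3 : ℝ) := by
  rw [← Real.rpow_natCast, ← Real.rpow_mul hx]
  congr 1; ring

theorem Execution.expectedRegret_le_of_tuned {X : Type*} [MeasurableSpace X] {K m : ℕ}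
    {I : PPCInstance X K m} {ε : ℝ} {T : ℕ} {Ω : Type*} [MeasurableSpace Ω] {P : Measure Ω}
    [IsProbabilityMeasure P] (E : Execution I ε T P) (G : GreedyRule K m) {α C : ℝ}
    (hε : ε = min 1 (2 * (T : ℝ) ^ (-(1 / 3) : ℝ) * Real.log (T * m * K) ^ (1 / 3 : ℝ)
      * (K : ℝ) ^ (4 / 3 : ℝ)))
    (hα : 0 < α) (hα1 : α ≤ 1) (hC : 0 ≤ C) (hE : E.CorruptedAtMost C)
    (hrat : E.AlphaRational G α) :
    E.expectedRegret G ≤ 100 * (1 + Real.log (T * m * K)) ^ 2 *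
      ((T : ℝ) ^ (2 / 3 : ℝ) * (K : ℝ) ^ (4 / 3 : ℝ)
        + (T : ℝ) ^ (1 / 3 : ℝ) * (K : ℝ) ^ (2 / 3 : ℝ) / α ^ 2 + C / α + K * C) := by
  have hK := E.arms_pos
  have hm := G.experts_pos
  have hReg := E.expectedRegret_le_horizon G
  rcases Nat.eq_zero_or_pos T with hT0 | hT
  · have hz : (T : ℝ) = 0 := by exact_mod_cast hT0
    exact (hReg.trans_eq hz).trans (by positivity)
  have hK' : (1 : ℝ) ≤ K := by exact_mod_cast hK
  have hT' : (1 : ℝ) ≤ T := by exact_mod_cast hT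
  have hm' : (1 : ℝ) ≤ m := by exact_mod_cast hm
  have hprod : (T : ℝ) ≤ T * m * K := by
    rw [mul_assoc]
    exact le_mul_of_one_le_right (by linarith) (one_le_mul_of_one_le_of_one_le hm' hK')
  have hlogT : Real.log T ≤ Real.log (T * m * K) := Real.log_le_log (by linarith) hprod
  have hlogT0 : 0 ≤ Real.log T := Real.log_natCast_nonneg T
  have hx : 1 ≤ (T : ℝ) ^ (1 / 3 : ℝ) := Real.one_le_rpow hT' (by norm_num)
  have hk : 1 ≤ (K : ℝ) ^ (1 / 3 : ℝ) := Real.one_le_rpow hK' (by norm_num)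
  have hTneg : (T : ℝ) ^ (-(1 / 3) : ℝ) = ((T : ℝ) ^ (1 / 3 : ℝ))⁻¹ :=
    Real.rpow_neg (by linarith) _
  have hx2 := rpow_third_pow (x := (T : ℝ)) (by linarith) 2
  have hx3 := rpow_third_pow (x := (T : ℝ)) (by linarith) 3
  have hk2 := rpow_third_pow (x := (K : ℝ)) (by linarith) 2
  have hk3 := rpow_third_pow (x := (K : ℝ)) (by linarith) 3
  have hk4 := rpow_third_pow (x := (K : ℝ)) (by linarith) 4
  have hl3 := rpow_third_pow (hlogT0.trans hlogT) 3
  norm_num only [Real.rpow_one] at hx2 hx3 hk2 hk3 hk4 hl3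
  set L := Real.log (T * m * K) with hL
  have hL0 : 0 ≤ L := hlogT0.trans hlogT
  rw [hTneg] at hε
  rw [← hx2, ← hk2, ← hk4]
  rw [← hk4] at hε
  set x := (T : ℝ) ^ (1 / 3 : ℝ)
  set k := (K : ℝ) ^ (1 / 3 : ℝ)
  set l := L ^ (1 / 3 : ℝ) with hl
  have hM : 1 ≤ (1 + L) ^ 2 := one_le_pow₀ (by linarith)
  have hxk : 1 ≤ x ^ 2 * k ^ 4 :=
    one_le_mul_of_one_le_of_one_le (one_le_pow₀ hx) (one_le_pow₀ hk)
  have hr : 0 ≤ x * k ^ 2 / α ^ 2 + C / α + K * C := by positivity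
  have hcrude : ∀ r : ℝ, r ≤ 2 * (1 + L) * (x ^ 2 * k ^ 4) → r ≤ 100 * (1 + L) ^ 2 *
      (x ^ 2 * k ^ 4 + x * k ^ 2 / α ^ 2 + C / α + K * C) := by
    intro r hr'
    refine hr'.trans (mul_le_mul ?_ ?_ (by positivity) (by positivity))
    · nlinarith
    · linarith
  -- if `T m K = 1` then `ε = 0`, which the bound for a fixed exploration rate does not cover
  rcases hL0.eq_or_lt with hLz | hLpos
  · refine hcrude _ ?_
    have h1 : (T : ℝ) ≤ 1 := by
      by_contra h
      exact absurd hLz (Real.log_pos ((not_le.1 h).trans_le hprod)).ne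
    rw [← hLz]
    linarith
  have hlpos : 0 < l := Real.rpow_pos_of_pos hLpos _
  have hxpos : 0 < x := by linarith
  have hform : 2 * x⁻¹ * l * k ^ 4 = 2 * l * k ^ 4 / x := by ring
  rw [hform] at hε
  rcases le_total 1 (2 * l * k ^ 4 / x) with h1 | h1
  · refine hcrude _ (hReg.trans ?_)
    rw [le_div_iff₀ hxpos, one_mul] at h1
    have hl1 : l ≤ 1 + L := by
      rw [← hl3]; nlinarith [sq_nonneg (l - 1), sq_nonneg (l + 1)]
    calc (T : ℝ) = x ^ 2 * x := by rw [← hx3]; ring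
      _ ≤ x ^ 2 * (2 * l * k ^ 4) := by gcongr
      _ = 2 * l * (x ^ 2 * k ^ 4) := by ring
      _ ≤ _ := by gcongr
  · rw [min_eq_right h1] at hε
    have hεpos : 0 < ε := by rw [hε]; positivity
    have hmain := E.expectedRegret_le G hεpos (hε.trans_le h1) hα hα1 hC hE hrat
    have hD : corruptionTerm K T ε C ≤ 2 * C + 6 * k ^ 3 * Real.log T / (2 * l * k ^ 4 / x) := by
      have h2 : 0 ≤ 6 * (K : ℝ) * Real.log T / ε := by positivity
      rw [← hε, hk3, corruptionTerm, two_mul, add_assoc]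
      exact add_le_add le_rfl (max_le (by linarith) (by linarith))
    have := tuned_bound_le hx hk hlpos hα hα1 hC hlogT0 (hlogT.trans hl3.ge) hD
    rw [← hε, hx3, hk3, hl3] at this
    exact hmain.trans this

theorem mainTheorem2 :
    (∀ (K m T : ℕ) (ε α C : ℝ), 0 < ε → ε ≤ 1 → 0 < α → α ≤ 1 → 0 ≤ C →
      ∀ (X : Type*) [MeasurableSpace X] (I : PPCInstance X K m) (G : GreedyRule K m)
        (Ω : Type*) [MeasurableSpace Ω] (P : Measure Ω) [IsProbabilityMeasure P]
        (E : Execution I ε T P), E.CorruptedAtMost C → E.AlphaRational G α →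
        E.expectedRegret G ≤
          T * ε + (K : ℝ) ^ 2 * √(8 * T * Real.log (T * m * K) / ε) + 3 * K
            + 8 * (K : ℝ) ^ 2 * Real.log (T * m * K) / (ε * α ^ 2)
            + 16 * corruptionTerm K T ε C / α
            + 4 * K * corruptionTerm K T ε C * Real.log T) ∧
    (∃ (c : ℝ) (p : ℕ), ∀ (K m T : ℕ) (ε α C : ℝ),
      ε = min 1 (2 * (T : ℝ) ^ (-(1 / 3) : ℝ) * Real.log (T * m * K) ^ (1 / 3 : ℝ)
            * (K : ℝ) ^ (4 / 3 : ℝ)) →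
      0 < α → α ≤ 1 → 0 ≤ C →
      ∀ (X : Type*) [MeasurableSpace X] (I : PPCInstance X K m) (G : GreedyRule K m)
        (Ω : Type*) [MeasurableSpace Ω] (P : Measure Ω) [IsProbabilityMeasure P]
        (E : Execution I ε T P), E.CorruptedAtMost C → E.AlphaRational G α →
        E.expectedRegret G ≤ c * (1 + Real.log (T * m * K)) ^ p *
          ((T : ℝ) ^ (2 / 3 : ℝ) * (K : ℝ) ^ (4 / 3 : ℝ)
            + (T : ℝ) ^ (1 / 3 : ℝ) * (K : ℝ) ^ (2 / 3 : ℝ) / α ^ 2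
            + C / α + K * C)) := by
  refine ⟨?_, 100, 2, ?_⟩
  · intro K m T ε α C hε hε1 hα hα1 hC X _ I G Ω _ P _ E hE hrat
    exact E.expectedRegret_le G hε hε1 hα hα1 hC hE hrat
  · intro K m T ε α C hε hα hα1 hC X _ I G Ω _ P _ E hE hrat
    exact E.expectedRegret_le_of_tuned G hε hα hα1 hC hE hrat
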